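/- Let $\mathbb F_q$ be the finite field with $q$ elements, $K=\mathbb F_q(\theta)$, $K_\infty=\mathbb F_q((1/\theta))$ with $|\theta|_\infty=q$, and let $\mathbb C_\infty$ be a complete, algebraically closed extension of $K_\infty$ carrying an extension of $|\cdot|_\infty$; $K_\infty^{\rm sep}$ is the separable closure of $K_\infty$ in $\mathbb C_\infty$. The hyperderivatives $\partial_\theta^{(j)}$ ($j\ge 0$) on $K_\infty$ are given by $\partial_\theta^{(j)}\bigl(\sum_i c_i\theta^{-i}\bigr)=\sum_i c_i\binom{-i}{j}\theta^{-i-j}$; they extend uniquely to a higher derivation on $K_\infty^{\rm sep}$, then $t$-linearly to $K_\infty^{\rm sep}[t]$, and to power series in $t-\theta$ by $\sum_{j\ge0}\partial_\theta^{(j)}\bigl(\sum_m a_m(t-\theta)^m\bigr)X^j=\sum_m\bigl(\sum_{k\ge0}\partial_\theta^{(k)}(a_m)X^k\bigr)(t-\theta-X)^m$. Put $$\eta=\prod_{m\ge1}\Bigl(1+\frac{(t-\theta)^{q^m}}{\theta^{q^m}-\theta}\Bigr),\quad D_m=\prod_{k=0}^{m-1}(\theta^{q^m}-\theta^{q^k}),\quad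 \gamma_m(t)=\prod_{k=1}^{m}(\theta^{q^m}-t^{q^k}),\quad \Gamma_m=\prod_j D_j^{m_j},$$ where $m=\sum_j m_jq^j$ is the base-$q$ expansion of $m$, and let the polynomials $\alpha_n(t)\in K[t]$ ($n\ge1$) be defined by $$\sum_{n\ge1}\frac{\alpha_n(t)}{\Gamma_n}x^{n-1}=\Bigl(1-\sum_{j\ge0}\frac{\gamma_j(t)}{D_j}x^{q^j}\Bigr)^{-1}.$$ Let $\lambda_\theta\in K_\infty^{\rm sep}$ satisfy $\lambda_\theta^{q-1}=-\theta$, and let $\tilde\pi=\lambda_\theta\,\theta\prod_{j\ge1}(1-\theta^{1-q^j})^{-1}$ be the Carlitz period. For $n\ge1$ let $N$ be the $n\times n$ matrix with ones on the superdiagonal and zeros elsewhere, and $E$ the $n\times n$ matrix whose only non-zero entry is a $1$ in the lower left corner. Let $C^{\otimes n}$ be the $n$-th Carlitz tensor power, i.e. the $t$-module on which $t$ acts by $x\mapsto(\theta I+N)x+Ex^{(1)}$, where $x^{(i)}$ denotes the vector of the $q^i$-th powers of the coordinates. Let $\exp_n(z)=\sum_{i\ge0}Q_iz^{(i)}$ be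 its exponential function, so $Q_0=I$ and $\exp_n((\theta I+N)z)=(\theta I+N)\exp_n(z)+E\exp_n(z)^{(1)}$. A fundamental period of $C^{\otimes n}$ is a generator of $\ker(\exp_n)\subset\mathbb C_\infty^n$ as an $\mathbb F_q[t]$-module, where $t$ acts on $\mathbb C_\infty^n$ as $\theta I+N$. Then, for all $n\ge1$: 1. For all $0\le j\le n$, $$\partial_\theta^{(j)}(\eta^{-n})\big|_{t=\theta}=\partial_\theta^{(j)}\Bigl(\frac{\alpha_n(t)}{\Gamma_n}\Bigr)\Big|_{t=\theta}.$$ 2. If $(z_1,\dots,z_n)$ is a fundamental period of $C^{\otimes n}$ with last coordinate $z_n=\tilde\pi^n$, then for all $0\le j\le n-1$, $$z_{n-j}=\partial_\theta^{(j)}\Bigl(\frac{\alpha_n(t)}{\Gamma_n}\,\tilde\pi^n\Bigr)\Big|_{t=\theta}.$$ -/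

import Mathlib

open scoped LaurentSeries

noncomputable section

namespace CarlitzPeriod

/-! ### Hyperderivatives with respect to `θ` on `K_∞ = F((1/θ))` -/

section KInfty

variable {F : Type*} [Field F]

/-- The variable `θ` of `K_∞`. The field `K_∞ = F((1/θ))` is the field of Laurent series over `F`
whose variable `single 1 1` is `1/θ`. -/
def thetaInf (F : Type*) [Field F] : F⸨X⸩ := HahnSeries.single (-1) 1

/-- The hyperderivative `∂_θ^{(n)} (∑ c_i θ^{-i}) = ∑ c_i binom(-i, n) θ^{-i-n}` on `K_∞`.
The coefficient of `θ^{-k}` of the right-hand side is the one with `i = k - n`. -/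
def hyperderivInf (n : ℕ) (x : F⸨X⸩) : F⸨X⸩ :=
  HahnSeries.ofSuppBddBelow (fun k : ℤ => (Ring.choose ((n : ℤ) - k) n : ℤ) • x.coeff (k - n)) <| by
    refine ⟨x.order + n, fun k h => ?_⟩
    contrapose! h
    rw [Function.notMem_support,
      HahnSeries.coeff_eq_zero_of_lt_order (by omega), smul_zero]

theorem hyperderivInf_coeff (n : ℕ) (x : F⸨X⸩) (k : ℤ) :
    (hyperderivInf n x).coeff k = (Ring.choose ((n : ℤ) - k) n : ℤ) • x.coeff (k - n) := rfl

theorem coeff_mul_eq_sum_Icc (x y : F⸨X⸩) (a b k : ℤ) (hx : ∀ i < a, x.coeff i = 0)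
    (hy : ∀ i < b, y.coeff i = 0) :
    (x * y).coeff k = ∑ i ∈ Finset.Icc a (k - b), x.coeff i * y.coeff (k - i) := by
  rw [HahnSeries.coeff_mul]
  refine Finset.sum_bij_ne_zero (fun p _ _ => p.1) ?_ ?_ ?_ ?_
  · intro p hp _
    rw [Finset.mem_antidiagonal] at hp
    obtain ⟨h1, h2, h3⟩ := hp
    rw [Finset.mem_Icc]
    constructor
    · by_contra h
      exact h1 (hx _ (not_le.mp h))
    · by_contra h
      exact h2 (hy _ (by omega))
  · intro p hp _ p' hp' _ h
    rw [Finset.mem_antidiagonal] at hp hp'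
    refine Prod.ext h ?_
    have h3 := hp.2.2
    have h4 := hp'.2.2
    omega
  · intro i _ hi
    refine ⟨(i, k - i), ?_, hi, rfl⟩
    rw [Finset.mem_antidiagonal]
    exact ⟨left_ne_zero_of_mul hi, right_ne_zero_of_mul hi, by simp⟩
  · intro p hp _
    rw [Finset.mem_antidiagonal] at hp
    rw [show k - p.1 = p.2 by have := hp.2.2; omega]

/-- The generalized Leibniz rule on `K_∞`. -/
theorem hyperderivInf_mul (n : ℕ) (x y : F⸨X⸩) :
    hyperderivInf n (x * y)
      = ∑ p ∈ Finset.HasAntidiagonal.antidiagonal n, hyperderivInf p.1 x * hyperderivInf p.2 y := by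
  ext k
  have hx : ∀ i < x.order, x.coeff i = 0 := fun i => HahnSeries.coeff_eq_zero_of_lt_order
  have hy : ∀ i < y.order, y.coeff i = 0 := fun i => HahnSeries.coeff_eq_zero_of_lt_order
  have key : ∀ p ∈ Finset.HasAntidiagonal.antidiagonal n, (hyperderivInf p.1 x * hyperderivInf p.2 y).coeff k
      = ∑ i ∈ Finset.Icc x.order (k - n - y.order),
        (Ring.choose (-i : ℤ) p.1 * Ring.choose ((n : ℤ) - k + i) p.2 : ℤ) •
          (x.coeff i * y.coeff (k - n - i)) := by
    intro p hp
    have hpn : p.1 + p.2 = n := Finset.HasAntidiagonal.mem_antidiagonal.mp hp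
    rw [coeff_mul_eq_sum_Icc _ _ (x.order + p.1) (y.order + p.2)]
    · refine Finset.sum_bij' (fun i _ => i - p.1) (fun i _ => i + p.1) ?_ ?_ ?_ ?_ ?_
      · intro i hi
        rw [Finset.mem_Icc] at hi ⊢
        omega
      · intro i hi
        rw [Finset.mem_Icc] at hi ⊢
        omega
      · intro i _; simp
      · intro i _; simp
      · intro i _
        rw [hyperderivInf_coeff, hyperderivInf_coeff,
          show k - i - (p.2 : ℤ) = k - n - (i - p.1) by omega,
          show ((p.1 : ℤ) - i) = -(i - p.1) by omega,
          show ((p.2 : ℤ) - (k - i)) = (n : ℤ) - k + (i - p.1) by omega,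
          smul_mul_smul_comm]
    · intro i hi
      rw [hyperderivInf_coeff, hx _ (by omega), smul_zero]
    · intro i hi
      rw [hyperderivInf_coeff, hy _ (by omega), smul_zero]
  rw [HahnSeries.coeff_sum, Finset.sum_congr rfl key, Finset.sum_comm, hyperderivInf_coeff,
    coeff_mul_eq_sum_Icc x y x.order y.order (k - n) hx hy, Finset.smul_sum]
  refine Finset.sum_congr rfl fun i _ => ?_
  rw [← Finset.sum_smul, ← Ring.add_choose_eq n (Commute.all _ _)]
  congr 2
  ring

/-- The Taylor series homomorphism `f ↦ ∑ ∂_θ^{(n)}(f) X^n` of `K_∞`. -/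
def taylorInf (F : Type*) [Field F] : F⸨X⸩ →+* PowerSeries F⸨X⸩ where
  toFun x := PowerSeries.mk fun n => hyperderivInf n x
  map_one' := by
    ext n k
    rw [PowerSeries.coeff_mk, hyperderivInf_coeff, PowerSeries.coeff_one]
    by_cases hn : n = 0
    · subst hn; simp
    · rw [if_neg hn, HahnSeries.coeff_one]
      by_cases hk : k - n = 0
      · rw [if_pos hk, show ((n : ℤ) - k) = 0 by omega, Ring.choose_zero_pos _ (by omega)]
        simp
      · rw [if_neg hk, smul_zero, HahnSeries.coeff_zero]
  map_zero' := by
    ext n k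
    simp [hyperderivInf_coeff]
  map_add' x y := by
    ext n k
    simp [hyperderivInf_coeff]
  map_mul' x y := by
    ext n : 1
    rw [PowerSeries.coeff_mk, PowerSeries.coeff_mul, hyperderivInf_mul]
    simp

theorem constantCoeff_taylorInf (x : F⸨X⸩) :
    PowerSeries.constantCoeff (taylorInf F x) = x := by
  ext k
  rw [← PowerSeries.coeff_zero_eq_constantCoeff_apply]
  simp [taylorInf, hyperderivInf_coeff]

end KInfty

/-! ### Extension of hyperderivatives to separable algebraic extensions -/

theorem exists_unique_lift {K E S : Type*} [Field K] [Field E] [CommRing S] [Algebra K E]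
    [Algebra.IsSeparable K E] (I : Ideal S) [IsAdicComplete I S] (e : S →+* E)
    (he : Function.Surjective e) (hker : RingHom.ker e = I) (f : K →+* S)
    (hf : e.comp f = algebraMap K E) :
    ∃! D : E →+* S, (∀ x, e (D x) = x) ∧ ∀ x, D (algebraMap K E x) = f x := by
  subst hker
  let : Algebra K S := f.toAlgebra
  let e' : S →ₐ[K] E := { e with commutes' := fun x => RingHom.congr_fun hf x }
  have := Algebra.FormallyEtale.of_isSeparable K E
  have he' : Function.Surjective e' := he
  obtain ⟨g, hg⟩ := Algebra.FormallySmooth.exists_mkₐ_comp_eq_of_isAdicComplete (R := K) (A := E)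
    (I := RingHom.ker e) ((Ideal.quotientKerAlgEquivOfSurjective he').symm.toAlgHom)
  have hg' : ∀ x, e (g x) = x := by
    intro x
    have h1 := congr(Ideal.quotientKerAlgEquivOfSurjective he' ($hg x))
    have h2 : Ideal.quotientKerAlgEquivOfSurjective he'
      ((Ideal.quotientKerAlgEquivOfSurjective he').symm.toAlgHom x) = x := by simp
    rw [h2] at h1
    exact h1
  refine ⟨g, ⟨hg', fun x => g.commutes x⟩, ?_⟩
  rintro D ⟨hD, hD'⟩
  let D' : E →ₐ[K] S := { D with commutes' := hD' }
  have : D' = g := by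
    refine Algebra.FormallyUnramified.ext_of_iInf (I := RingHom.ker e) ?_ ?_
    · have := IsHausdorff.iInf_pow_smul (I := RingHom.ker e) (M := S) inferInstance
      simpa using this
    · intro x
      rw [Ideal.Quotient.eq, RingHom.mem_ker, map_sub, hg' x, sub_eq_zero]
      exact hD x
  rw [← this]
  rfl

/-- A Taylor series homomorphism on a field extends uniquely to a separable algebraic extension. -/
theorem exists_unique_taylor {K E : Type*} [Field K] [Field E] [Algebra K E]
    [Algebra.IsSeparable K E] (D₀ : K →+* PowerSeries K)
    (hD₀ : ∀ x, PowerSeries.constantCoeff (D₀ x) = x) :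
    ∃! D : E →+* PowerSeries E, (∀ x, PowerSeries.constantCoeff (D x) = x) ∧
      ∀ x, D (algebraMap K E x) = PowerSeries.map (algebraMap K E) (D₀ x) := by
  refine exists_unique_lift (Ideal.span {PowerSeries.X}) PowerSeries.constantCoeff
    PowerSeries.constantCoeff_surj ?_ ((PowerSeries.map (algebraMap K E)).comp D₀) ?_
  · ext f
    rw [RingHom.mem_ker, Ideal.mem_span_singleton, PowerSeries.X_dvd_iff]
  · ext x
    rw [RingHom.comp_apply, RingHom.comp_apply, ← PowerSeries.coeff_zero_eq_constantCoeff_apply,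
      PowerSeries.coeff_map,
      PowerSeries.coeff_zero_eq_constantCoeff_apply, hD₀]

section Separable

variable (F : Type*) [Field F] (L : Type*) [Field L] [Algebra F⸨X⸩ L]

/-- `K_∞^sep`, realised as the separable closure of `K_∞` in the ambient field `L`. -/
abbrev KSep : Type _ := separableClosure F⸨X⸩ L

/-- The Taylor series homomorphism `f ↦ ∑ ∂_θ^{(n)}(f) X^n` of `K_∞^sep`: the unique extension of
the one of `K_∞`. -/
def taylorSep : KSep F L →+* PowerSeries (KSep F L) :=
  (exists_unique_taylor (E := KSep F L) (taylorInf F) constantCoeff_taylorInf).choose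

theorem taylorSep_spec :
    (∀ x, PowerSeries.constantCoeff (taylorSep F L x) = x) ∧
      ∀ x, taylorSep F L (algebraMap F⸨X⸩ (KSep F L) x)
        = PowerSeries.map (algebraMap F⸨X⸩ (KSep F L)) (taylorInf F x) :=
  (exists_unique_taylor (E := KSep F L) (taylorInf F) constantCoeff_taylorInf).choose_spec.1

/-- The hyperderivative `∂_θ^{(j)}` on `K_∞^sep`. -/
def hyperderiv (j : ℕ) (x : KSep F L) : KSep F L := PowerSeries.coeff j (taylorSep F L x)

/-- The variable `θ` in `K_∞^sep`. -/
def thetaSep : KSep F L := algebraMap F⸨X⸩ (KSep F L) (thetaInf F)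

/-- The `t`-linear extension of `∂_θ^{(j)}` to polynomials in `t`. -/
def hyperderivPoly (j : ℕ) (f : Polynomial (KSep F L)) : Polynomial (KSep F L) :=
  f.sum fun i a => Polynomial.monomial i (hyperderiv F L j a)

/-- The extension of `∂_θ^{(j)}` to power series `f = ∑ a_m (t - θ)^m`; the variable of the power
series ring is `t - θ`. As `θ ↦ θ + X` sends `a_m (t - θ)^m` to
`(∑ ∂_θ^{(k)}(a_m) X^k) (t - θ - X)^m`, the coefficient of `(t - θ)^m` in `∂_θ^{(j)} f` is
`∑_{i ≤ j} (-1)^i binom(m + i, i) ∂_θ^{(j - i)}(a_{m + i})`. -/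
def hyperderivSeries (j : ℕ) (f : PowerSeries (KSep F L)) : PowerSeries (KSep F L) :=
  PowerSeries.mk fun m => ∑ i ∈ Finset.range (j + 1),
    (-1) ^ i * ((m + i).choose i : KSep F L) * hyperderiv F L (j - i) (PowerSeries.coeff (m + i) f)

end Separable

/-! ### The series `η` and the Anderson-Thakur polynomials -/

section AndersonThakur

variable {R : Type*} [Field R] (q : ℕ) (θ : R)

/-- `η_l = ∏_{m=1}^l (1 + (t - θ)^{q^m} / (θ^{q^m} - θ))`, as a power series in `t - θ`. -/
def etaPartial (l : ℕ) : PowerSeries R :=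
  ∏ m ∈ Finset.Icc 1 l, (1 + PowerSeries.C (θ ^ q ^ m - θ)⁻¹ * PowerSeries.X ^ q ^ m)

/-- `η = lim η_l`, as a power series in `t - θ`. The coefficient of `(t - θ)^k` of `η_l` does not
depend on `l` for `l ≥ k`, see `coeff_eta`. -/
def eta : PowerSeries R := PowerSeries.mk fun k => PowerSeries.coeff k (etaPartial q θ k)

theorem coeff_eta (hq : 2 ≤ q) {k l : ℕ} (h : k ≤ l) :
    PowerSeries.coeff k (eta q θ) = PowerSeries.coeff k (etaPartial q θ l) := by
  induction l, h using Nat.le_induction with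
  | base => simp [eta]
  | succ l hl ih =>
    rw [ih, etaPartial, etaPartial, ← Finset.insert_Icc_right_eq_Icc_add_one (by omega),
      Finset.prod_insert (by simp), add_mul, one_mul, map_add, mul_assoc,
      PowerSeries.coeff_C_mul, PowerSeries.coeff_X_pow_mul', if_neg, mul_zero, add_zero]
    have := Nat.lt_pow_self (n := l + 1) (a := q) (by omega)
    omega

/-- `D_m = ∏_{k=0}^{m-1} (θ^{q^m} - θ^{q^k})`. -/
def carlitzD (m : ℕ) : R := ∏ k ∈ Finset.range m, (θ ^ q ^ m - θ ^ q ^ k)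

/-- The Carlitz factorial `Γ_m = ∏_j D_j^{m_j}`, where the `m_j` are the base-`q` digits of `m`. -/
def carlitzGamma (m : ℕ) : R :=
  ∏ j ∈ Finset.range (q.digits m).length, carlitzD q θ j ^ (q.digits m).getD j 0

/-- `γ_m(t) = ∏_{k=1}^m (θ^{q^m} - t^{q^k})`. -/
def gammaPoly (m : ℕ) : Polynomial R :=
  ∏ k ∈ Finset.Icc 1 m, (Polynomial.C (θ ^ q ^ m) - Polynomial.X ^ q ^ k)

/-- `∑_{j ≥ 0} (γ_j(t) / D_j) x^{q^j}`, as a power series in `x` over the polynomials in `t`. (For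
`q ≥ 2`, the equation `q ^ j = k` has at most one solution `j`, and `j ≤ k`.) -/
def gammaSeries : PowerSeries (Polynomial R) :=
  PowerSeries.mk fun k => ∑ j ∈ Finset.range (k + 1),
    if q ^ j = k then Polynomial.C (carlitzD q θ j)⁻¹ * gammaPoly q θ j else 0

/-- The Anderson-Thakur polynomial `α_n(t)`, `n ≥ 1`: `α_n / Γ_n` is the coefficient of `x^{n-1}`
in the inverse of `1 - ∑_{j ≥ 0} (γ_j(t) / D_j) x^{q^j}`. -/
def andersonThakur (n : ℕ) : Polynomial R :=
  Polynomial.C (carlitzGamma q θ n) *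
    PowerSeries.coeff (n - 1) (PowerSeries.invOfUnit (1 - gammaSeries q θ) 1)

/-- `α_n(t) / Γ_n`. -/
def andersonThakurQuot (n : ℕ) : Polynomial R :=
  Polynomial.C (carlitzGamma q θ n)⁻¹ * andersonThakur q θ n

/-- The series that is inverted in `andersonThakur` has constant coefficient `1`. -/
theorem one_sub_gammaSeries_mul :
    (1 - gammaSeries q θ) * PowerSeries.invOfUnit (1 - gammaSeries q θ) 1 = 1 := by
  apply PowerSeries.mul_invOfUnit
  rw [← PowerSeries.coeff_zero_eq_constantCoeff_apply]
  simp [gammaSeries]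

end AndersonThakur

/-! ### Carlitz tensor powers: exponential function and periods -/

section TensorPower

variable {L : Type*} [Field L] (q : ℕ) (θ : L) (n : ℕ)

/-- The nilpotent matrix `N` with ones on the superdiagonal. -/
def shiftN (L : Type*) [Field L] (n : ℕ) : Matrix (Fin n) (Fin n) L :=
  Matrix.of fun i j => if i.val + 1 = j.val then 1 else 0

/-- The matrix `E` whose only non-zero entry is a one in the lower left corner. -/
def cornerE (L : Type*) [Field L] (n : ℕ) : Matrix (Fin n) (Fin n) L :=
  Matrix.of fun i j => if i.val + 1 = n ∧ j.val = 0 then 1 else 0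

/-- `θ I + N`: the action of `t` on the Lie algebra of the `n`-th Carlitz tensor power `C^{⊗n}`.
On `C^{⊗n}` itself, `t` acts as `x ↦ (θ I + N) x + E x^{(1)}`, where `x^{(i)}` denotes the vector
of the `q^i`-th powers of the coordinates. -/
def lieTheta : Matrix (Fin n) (Fin n) L := θ • (1 : Matrix (Fin n) (Fin n) L) + shiftN L n

/-- `M ↦ M N - N M`. -/
def adN (M : Matrix (Fin n) (Fin n) L) : Matrix (Fin n) (Fin n) L :=
  M * shiftN L n - shiftN L n * M

/-- The coefficients `Q_i` of the exponential function `exp(z) = ∑ Q_i z^{(i)}` of `C^{⊗n}`. They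
are determined by `Q_0 = I` and `exp((θ I + N) z) = (θ I + N) exp(z) + E exp(z)^{(1)}`, that is, by
`Q_{i+1} (θ^{q^{i+1}} I + N) = (θ I + N) Q_{i+1} + E Q_i^{(1)}`, see `expCoeff_succ`. The equation
`c Q + (Q N - N Q) = M` with `c = θ^{q^{i+1}} - θ ≠ 0` is solved by a finite geometric series. -/
def expCoeff : ℕ → Matrix (Fin n) (Fin n) L
  | 0 => 1
  | i + 1 => ∑ m ∈ Finset.range (2 * n),
      ((-1) ^ m * ((θ ^ q ^ (i + 1) - θ) ^ (m + 1))⁻¹) •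
        (adN n)^[m] (cornerE L n * (expCoeff i).map (· ^ q))

theorem shiftN_pow_apply (m : ℕ) (i j : Fin n) :
    (shiftN L n ^ m) i j = if i.val + m = j.val then 1 else 0 := by
  induction m generalizing i j with
  | zero => simp [Matrix.one_apply, Fin.ext_iff]
  | succ m ih =>
    rw [pow_succ', Matrix.mul_apply]
    by_cases h : i.val + 1 < n
    · rw [Finset.sum_eq_single ⟨i.val + 1, h⟩]
      · rw [ih]
        simp [shiftN, add_assoc, add_comm 1 m]
      · intro b _ hb
        have : ¬ (i.val + 1 = b.val) := fun h' => hb (Fin.ext h'.symm)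
        simp [shiftN, this]
      · simp
    · rw [Finset.sum_eq_zero, if_neg (by omega)]
      intro b _
      have : ¬ (i.val + 1 = b.val) := by omega
      simp [shiftN, this]

theorem shiftN_pow_self : shiftN L n ^ n = 0 := by
  ext i j
  rw [shiftN_pow_apply, if_neg (by omega), Matrix.zero_apply]

theorem adN_iterate (M : Matrix (Fin n) (Fin n) L) : (adN n)^[2 * n] M = 0 := by
  let a : Module.End L (Matrix (Fin n) (Fin n) L) := LinearMap.mulRight L (shiftN L n)
  let b : Module.End L (Matrix (Fin n) (Fin n) L) := LinearMap.mulLeft L (shiftN L n)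
  have hab : Commute a b := (LinearMap.commute_mulLeft_right (R := L) _ _).symm
  have ha : a ^ n = 0 := by
    rw [LinearMap.pow_mulRight, shiftN_pow_self, LinearMap.mulRight_zero_eq_zero]
  have hb : b ^ n = 0 := by
    rw [LinearMap.pow_mulLeft, shiftN_pow_self, LinearMap.mulLeft_zero_eq_zero]
  have h : (a - b) ^ (2 * n) = 0 := by
    rw [sub_eq_add_neg]
    refine hab.neg_right.add_pow_eq_zero_of_add_le_succ_of_pow_eq_zero (m := n) (n := n) ha ?_
      (by omega)
    rw [neg_pow, hb, mul_zero]
  have h2 : (adN n)^[2 * n] M = ((a - b) ^ (2 * n)) M := by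
    rw [Module.End.pow_apply]
    rfl
  rw [h2, h, LinearMap.zero_apply]

/-- The functional equation of the exponential function, coefficient by coefficient. -/
theorem expCoeff_succ (i : ℕ) (h : θ ^ q ^ (i + 1) - θ ≠ 0) :
    expCoeff q θ n (i + 1) * lieTheta (θ ^ q ^ (i + 1)) n
      = lieTheta θ n * expCoeff q θ n (i + 1)
        + cornerE L n * (expCoeff q θ n i).map (· ^ q) := by
  set c := θ ^ q ^ (i + 1) - θ with hc
  set M := cornerE L n * (expCoeff q θ n i).map (· ^ q) with hM
  let A : Module.End L (Matrix (Fin n) (Fin n) L) :=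
    LinearMap.mulRight L (shiftN L n) - LinearMap.mulLeft L (shiftN L n)
  have hA : ∀ B, A B = adN n B := fun B => rfl
  have hQ : expCoeff q θ n (i + 1) = ∑ m ∈ Finset.range (2 * n),
      ((-1) ^ m * (c ^ (m + 1))⁻¹) • (adN n)^[m] M := rfl
  have key : c • expCoeff q θ n (i + 1) + adN n (expCoeff q θ n (i + 1)) = M := by
    rw [hQ, ← hA, map_sum, Finset.smul_sum, ← Finset.sum_add_distrib]
    have : ∀ m ∈ Finset.range (2 * n),
        c • ((-1) ^ m * (c ^ (m + 1))⁻¹) • (adN n)^[m] M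
          + A (((-1) ^ m * (c ^ (m + 1))⁻¹) • (adN n)^[m] M)
        = ((-1) ^ m * (c ^ m)⁻¹) • (adN n)^[m] M
          - ((-1) ^ (m + 1) * (c ^ (m + 1))⁻¹) • (adN n)^[m + 1] M := by
      intro m _
      rw [map_smul, hA, Function.iterate_succ_apply', smul_smul, pow_succ (-1 : L), mul_neg_one,
        neg_mul, neg_smul, sub_neg_eq_add]
      congr 2
      rw [pow_succ]
      field_simp
    rw [Finset.sum_congr rfl this, Finset.sum_range_sub', adN_iterate]
    simp
  rw [← key]
  simp only [lieTheta, adN, hc, mul_add, add_mul, Matrix.mul_smul, Matrix.smul_mul, mul_one,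
    one_mul, sub_smul]
  abel

end TensorPower

section Period

variable {L : Type*} [NormedField L] (q : ℕ) (θ : L) (n : ℕ)

/-- The exponential function of the `n`-th Carlitz tensor power. -/
def tensorExp (z : Fin n → L) : Fin n → L :=
  ∑' i : ℕ, (expCoeff q θ n i).mulVec (fun k => z k ^ q ^ i)

/-- `z` is a fundamental period of `C^{⊗n}`: the kernel of the exponential function is generated by
`z` as an `F[t]`-module, where `t` acts as `θ I + N`. Here `ι` is the embedding of `F` in `L`. -/
def IsFundamentalPeriod {F : Type*} [Field F] (ι : F →+* L) (z : Fin n → L) : Prop :=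
  ∀ w : Fin n → L, tensorExp q θ n w = 0 ↔
    ∃ a : Polynomial F, w = (Polynomial.aeval (lieTheta θ n) (a.map ι)).mulVec z

end Period

/-! ### The Carlitz period -/

/-- The embedding of the constant field `F` in an extension `L` of `K_∞`. -/
def constEmb (F : Type*) [Field F] (L : Type*) [Field L] [Algebra F⸨X⸩ L] : F →+* L :=
  (algebraMap F⸨X⸩ L).comp HahnSeries.C

/-- The Carlitz period `λ θ ∏_{j ≥ 1} (1 - θ^{1 - q^j})⁻¹`, for a given `λ` in `K_∞^sep` (which is
to be a `(q-1)`-th root of `-θ`). The infinite product is taken in `K_∞` for the topology of its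
valuation. -/
def carlitzPeriod (F : Type*) [Field F] (q : ℕ) (L : Type*) [Field L] [Algebra F⸨X⸩ L]
    (lam : KSep F L) : KSep F L :=
  lam * thetaSep F L * algebraMap F⸨X⸩ (KSep F L)
    (∏' j : ℕ, (1 - thetaInf F ^ (1 - (q : ℤ) ^ (j + 1)))⁻¹)

end CarlitzPeriod

end

open CarlitzPeriod

noncomputable section

namespace CarlitzPeriod

/-! ### Powers of `q` in characteristic `p` -/

section Frobenius

variable {R : Type*} [CommRing R] {p f q : ℕ} [ExpChar R p]

/-! Write `T = t - θ` and `g_j = γ_j(t)/D_j`. The first assertion comes from a congruence: `α_n/Γ_n`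
and `η^{-n}` agree modulo `T^{n+1}`. Lagrange interpolation of `∏_{1≤j≤l} (u - t^{q^j})` at the
nodes `θ^{q^i}`, `0 ≤ i ≤ l`, has leading coefficient 1. Each summand splits into `g_i` (factors up
to `i`) and `η_{l-i}^{q^i}` (factors beyond `i`), so `∑ g_i η_{l-i}^{q^i} = 1`
(`sum_expandAt_gammaPoly_mul`). Hence `η` is, to the needed precision, a root of the additive series
`1 - ∑ g_j x^{q^j}`, which therefore equals `∑ g_j (η - x)^{q^j}`. The term `j = 0` contributes
`1/(η - x)` to the inverse, with coefficient `η^{-n}` at `x^{n-1}`. Since `T^{q^j}` divides `g_j`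
for `j ≥ 1`, the rest contributes a multiple of `T^{n+1}` (`pow_dvd_coeff_inverse_sub`). The value
at `t = θ` of `∂_θ^{(j)}` of a series in `T` only involves its coefficients up to `T^j`, so the
congruence suffices.

For the second assertion, the entries of `Q_i` are residues at `u = θ^{q^i}` of `(u -
θ^{q^i})^{n-1-c} (u - θ)^{-(n-r)} ∏_{1≤j≤i} (u - θ^{q^j})^{-n}` (`expCoeff_eq`). Replace the period
by the truncation `y_d = λ θ ∏_{1≤j≤d} (1 - t/θ^{q^j})^{-1}`, and let `Y_d` be the vector of the
first `n` coefficients in `T` of `y_d^n`. Then the terms `Q_i Y_{l-i}^{(i)}` with `i ≤ l` have as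
entries all the finite residues of one rational function that is `O(u^{-2})` at infinity, so they
sum to zero (`sum_expCoeff_mulVec_powCoeffs`). As `l → ∞`, the `y_l` tend coefficientwise to `∑_j
∂_θ^{(j)}(π̃/η)|_{t=θ} X^j` (`tendsto_periodSeries`), and dominated convergence puts the limiting
vector in the kernel of the exponential. That vector has last coordinate `π̃^n`. A fundamental
period `z` with the same last coordinate generates it as `a(θ I + N) z`; comparing last coordinates
gives `a(θ) = 1`, hence `a = 1`. The congruence then replaces `η^{-n}` by `α_n/Γ_n`. -/

theorem add_pow_qpow (hq : q = p ^ f) (m : ℕ) (x y : R) :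
    (x + y) ^ q ^ m = x ^ q ^ m + y ^ q ^ m := by
  rw [hq, ← pow_mul, add_pow_expChar_pow]

theorem sub_pow_qpow (hq : q = p ^ f) (m : ℕ) (x y : R) :
    (x - y) ^ q ^ m = x ^ q ^ m - y ^ q ^ m := by
  rw [hq, ← pow_mul, sub_pow_expChar_pow]

theorem neg_pow_qpow (hq : q = p ^ f) (m : ℕ) (hm : q ^ m ≠ 0) (x : R) :
    (-x) ^ q ^ m = -x ^ q ^ m := by
  have := sub_pow_qpow (R := R) hq m 0 x
  rwa [zero_sub, zero_pow hm, zero_sub] at this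

end Frobenius

instance expChar_powerSeries {K : Type*} [Field K] {p : ℕ} [ExpChar K p] :
    ExpChar (PowerSeries K) p :=
  expChar_of_injective_ringHom (f := PowerSeries.C) PowerSeries.C_injective p

theorem prod_range_erase {M : Type*} [CommMonoid M] (h : ℕ → M) (i d : ℕ) :
    ∏ j ∈ (Finset.range (i + d + 1)).erase i, h j
      = (∏ j ∈ Finset.range i, h j) * ∏ k ∈ Finset.range d, h (i + 1 + k) := by
  induction d with
  | zero =>
    rw [Finset.range_add_one, Finset.erase_insert (by simp)]
    simp
  | succ d ih =>
    rw [show i + (d + 1) + 1 = (i + d + 1) + 1 by ring, Finset.range_add_one,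
      Finset.erase_insert_of_ne (by omega), Finset.prod_insert (by simp), ih,
      Finset.prod_range_succ, show i + d + 1 = i + 1 + d by ring]
    rw [mul_comm, mul_assoc]

/-! ### The interpolation identity for `η` -/

section Interpolation

variable {K : Type*} [Field K] {p f q : ℕ} [ExpChar K p] {θ : K}

/-- The expansion of a polynomial in `t` as a power series in `t - θ`. -/
def expandAt (θ : K) : Polynomial K →+* PowerSeries K :=
  Polynomial.eval₂RingHom PowerSeries.C (PowerSeries.X + PowerSeries.C θ)

theorem qpow_sub_qpow (hq : q = p ^ f) (θ : K) (i k : ℕ) :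
    θ ^ q ^ (i + k) - θ ^ q ^ i = (θ ^ q ^ k - θ) ^ q ^ i := by
  rw [sub_pow_qpow hq, ← pow_mul, ← pow_add, add_comm]

theorem qpow_sub_ne_zero (hq : q = p ^ f) (hθ : ∀ m, θ ^ q ^ (m + 1) - θ ≠ 0) {i j : ℕ}
    (h : i ≠ j) : θ ^ q ^ i - θ ^ q ^ j ≠ 0 := by
  wlog hij : j < i generalizing i j
  · rw [← neg_sub]
    exact neg_ne_zero.mpr (this h.symm (by omega))
  · obtain ⟨d, rfl⟩ := Nat.exists_eq_add_of_lt hij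
    rw [add_assoc, qpow_sub_qpow hq]
    exact pow_ne_zero _ (hθ d)

theorem etaPartial_eq_prod_range (q : ℕ) (θ : K) (l : ℕ) :
    etaPartial q θ l = ∏ m ∈ Finset.range l,
      (1 + PowerSeries.C (θ ^ q ^ (m + 1) - θ)⁻¹ * PowerSeries.X ^ q ^ (m + 1)) := by
  rw [etaPartial, Finset.range_eq_Ico, Finset.prod_Ico_add' (fun m =>
    (1 + PowerSeries.C (θ ^ q ^ m - θ)⁻¹ * PowerSeries.X ^ q ^ m))]
  rfl

theorem expandAt_gammaPoly (q : ℕ) (θ : K) (i : ℕ) :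
    expandAt θ (gammaPoly q θ i) = ∏ k ∈ Finset.range i,
      (PowerSeries.C (θ ^ q ^ i) - (PowerSeries.X + PowerSeries.C θ) ^ q ^ (k + 1)) := by
  rw [gammaPoly, map_prod, Finset.range_eq_Ico, Finset.prod_Ico_add' (fun m =>
    (PowerSeries.C (θ ^ q ^ i) - (PowerSeries.X + PowerSeries.C θ) ^ q ^ m))]
  simp only [expandAt, map_sub, map_pow, Polynomial.coe_eval₂RingHom, Polynomial.eval₂_C,
    Polynomial.eval₂_X]
  rfl

/-- By additivity of Frobenius, the `q^i`-th power of `1 + (t - θ)^{q^m}/(θ^{q^m} - θ)` is `(θ^{q^i}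
- t^{q^{i+m}})/(θ^{q^i} - θ^{q^{i+m}})`. These are the factors beyond the `i`-th node in the
interpolation formula. -/
theorem etaPartial_pow_mul (hq : q = p ^ f) (hθ : ∀ m, θ ^ q ^ (m + 1) - θ ≠ 0) (i d : ℕ) :
    etaPartial q θ d ^ q ^ i
        * ∏ m ∈ Finset.range d, PowerSeries.C (θ ^ q ^ i - θ ^ q ^ (i + 1 + m))
      = ∏ m ∈ Finset.range d, (PowerSeries.C (θ ^ q ^ i)
          - (PowerSeries.X + PowerSeries.C θ) ^ q ^ (i + 1 + m)) := by
  rw [etaPartial_eq_prod_range, ← Finset.prod_pow, ← Finset.prod_mul_distrib]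
  refine Finset.prod_congr rfl fun m _ => ?_
  have h1 := qpow_sub_qpow hq θ i (m + 1)
  have h2 : (PowerSeries.C (θ ^ q ^ (m + 1) - θ)⁻¹) ^ q ^ i * PowerSeries.C
      ((θ ^ q ^ (m + 1) - θ) ^ q ^ i) = 1 := by
    rw [← map_pow, ← map_mul, inv_pow, inv_mul_cancel₀ (pow_ne_zero _ (hθ m)), map_one]
  rw [add_pow_qpow hq, add_pow_qpow hq, mul_pow, ← pow_mul, ← pow_add, one_pow,
    show i + 1 + m = i + (m + 1) by ring, ← neg_sub (θ ^ q ^ (i + (m + 1))), h1, map_neg, add_mul, mul_neg, mul_neg,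
    mul_right_comm, h2, ← h1, map_sub, ← map_pow, show m + 1 + i = i + (m + 1) by ring]
  ring

/-- Lagrange interpolation at `l + 1` nodes recovers the leading coefficient of a monic polynomial
of degree `l`. -/
theorem sum_prod_sub_div_prod_sub {k : Type*} [Field k] (v y : ℕ → k) (hv : Function.Injective v)
    (l : ℕ) : ∑ i ∈ Finset.range (l + 1), (∏ j ∈ Finset.range l, (v i - y j))
      / ∏ j ∈ (Finset.range (l + 1)).erase i, (v i - v j) = 1 := by
  let Q : Polynomial k := ∏ j ∈ Finset.range l, (Polynomial.X - Polynomial.C (y j))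
  have hQm : Q.Monic := Polynomial.monic_prod_of_monic _ _ fun k _ => Polynomial.monic_X_sub_C _
  have hQd : Q.natDegree = l := by
    rw [Polynomial.natDegree_finsetProd_X_sub_C_eq_card, Finset.card_range]
  have key := Lagrange.coeff_eq_sum (s := Finset.range (l + 1)) hv.injOn (P := Q) (by
    rw [Polynomial.degree_eq_natDegree hQm.ne_zero, hQd, Finset.card_range]
    exact_mod_cast Nat.lt_succ_self l)
  have hcoeff : Q.coeff l = 1 := by
    rw [← hQd]; exact hQm
  rw [Finset.card_range, Nat.add_sub_cancel, hcoeff] at key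
  rw [key]
  simp only [Q, Polynomial.eval_prod, Polynomial.eval_sub, Polynomial.eval_X, Polynomial.eval_C]

theorem sum_expandAt_gammaPoly_mul (hq : q = p ^ f) (hθ : ∀ m, θ ^ q ^ (m + 1) - θ ≠ 0) (l : ℕ) :
    ∑ i ∈ Finset.range (l + 1), PowerSeries.C (carlitzD q θ i)⁻¹ * expandAt θ (gammaPoly q θ i)
      * etaPartial q θ (l - i) ^ q ^ i = 1 := by
  -- Interpolation needs a field that contains both `θ` and `t`, so the identity is checked among
  -- Laurent series.
  obtain ⟨e, he⟩ : ∃ e : PowerSeries K →+* K⸨X⸩, Function.Injective e :=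
    ⟨HahnSeries.ofPowerSeries ℤ K, HahnSeries.ofPowerSeries_injective⟩
  have heC : Function.Injective (e.comp PowerSeries.C) := he.comp PowerSeries.C_injective
  let c := e.comp PowerSeries.C
  have key := sum_prod_sub_div_prod_sub (fun j => c (θ ^ q ^ j))
    (fun j => e ((PowerSeries.X + PowerSeries.C θ) ^ q ^ (j + 1))) (fun i j h => by
      by_contra hij
      exact qpow_sub_ne_zero hq hθ hij (sub_eq_zero.mpr (heC h))) l
  apply he
  rw [map_one, ← key, map_sum]
  refine Finset.sum_congr rfl fun i hi => ?_
  obtain ⟨d, rfl⟩ := Nat.exists_eq_add_of_le (Nat.lt_succ_iff.mp (Finset.mem_range.mp hi))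
  rw [Nat.add_sub_cancel_left, prod_range_erase]
  have hD : carlitzD q θ i ≠ 0 :=
    Finset.prod_ne_zero_iff.mpr fun k hk =>
      qpow_sub_ne_zero hq hθ (Finset.mem_range.mp hk).ne'
  have hP : ∏ k ∈ Finset.range d, (θ ^ q ^ i - θ ^ q ^ (i + 1 + k)) ≠ 0 :=
    Finset.prod_ne_zero_iff.mpr fun k hk => qpow_sub_ne_zero hq hθ (by omega)
  have h1 : ∏ j ∈ Finset.range i, (c (θ ^ q ^ i) - c (θ ^ q ^ j)) = c (carlitzD q θ i) := by
    rw [carlitzD, map_prod]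
    exact Finset.prod_congr rfl fun j _ => (map_sub c _ _).symm
  have h2 : ∏ k ∈ Finset.range d, (c (θ ^ q ^ i) - c (θ ^ q ^ (i + 1 + k)))
      = c (∏ k ∈ Finset.range d, (θ ^ q ^ i - θ ^ q ^ (i + 1 + k))) := by
    rw [map_prod]
    exact Finset.prod_congr rfl fun j _ => (map_sub c _ _).symm
  rw [h1, h2, eq_div_iff (mul_ne_zero ((map_ne_zero_iff _ heC).mpr hD)
    ((map_ne_zero_iff _ heC).mpr hP)), ← map_mul]
  have h3 : ∏ j ∈ Finset.range (i + d),
        (c (θ ^ q ^ i) - e ((PowerSeries.X + PowerSeries.C θ) ^ q ^ (j + 1)))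
      = e (∏ k ∈ Finset.range (i + d), (PowerSeries.C (θ ^ q ^ i)
      - (PowerSeries.X + PowerSeries.C θ) ^ q ^ (k + 1))) := by
    rw [map_prod]
    exact Finset.prod_congr rfl fun j _ => (map_sub e _ _).symm
  rw [h3, Finset.prod_range_add, ← expandAt_gammaPoly, RingHom.comp_apply, ← map_mul]
  congr 1
  have h4 := etaPartial_pow_mul hq hθ i d
  simp only [show ∀ x, i + x + 1 = i + 1 + x by intro x; ring]
  rw [← h4, ← map_prod, map_mul]
  have h5 : PowerSeries.C (carlitzD q θ i)⁻¹ * PowerSeries.C (carlitzD q θ i) = 1 := by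
    rw [← map_mul, inv_mul_cancel₀ hD, map_one]
  linear_combination (expandAt θ (gammaPoly q θ i) * etaPartial q θ d ^ q ^ i *
    PowerSeries.C (∏ m ∈ Finset.range d, (θ ^ q ^ i - θ ^ q ^ (i + 1 + m)))) * h5

end Interpolation

/-! ### Coefficients of the inverse of `1 - ∑ g_j x^{q^j}` -/

theorem coeff_mul_eq_zero_of_coeff_eq_zero {A : Type*} [CommRing A] {n k : ℕ} {a b : PowerSeries A}
    (ha : ∀ i ≤ n, PowerSeries.coeff i a = 0) (hk : k ≤ n) : PowerSeries.coeff k (a * b) = 0 := by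
  rw [PowerSeries.coeff_mul]
  refine Finset.sum_eq_zero fun x hx => ?_
  rw [ha _ ((Finset.HasAntidiagonal.antidiagonal.fst_le hx).trans hk), zero_mul]

/-- With `y = η - x`, additivity turns the approximate root `η` into a factorisation `1 - G ≈ y (1 +
T² y S)`. Its inverse is `1/y - T² S/(1 + T² y S)`. The first term is geometric in `x/η`; the second
is a series in `T x` times `T²`, so its coefficient at `x^{n-1}` is divisible by `T^{n+1}`. -/
theorem pow_dvd_coeff_inverse_sub {A : Type*} [CommRing A] {p f q : ℕ} [ExpChar (PowerSeries A) p]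
    (hq : q = p ^ f) (hq2 : 2 ≤ q) {T η η' : A} (hT : ∀ a, IsUnit (1 + T * a)) (hη : η * η' = 1)
    {g : ℕ → A} (hg0 : g 0 = 1) (hg : ∀ j, T ^ q ^ (j + 1) ∣ g (j + 1)) {n : ℕ} (hn : 1 ≤ n)
    (hroot : T ^ (n + 1) ∣ 1 - ∑ j ∈ Finset.range (n + 1), g j * η ^ q ^ j)
    {G B : PowerSeries A} (hGB : (1 - G) * B = 1)
    (hG : ∀ k ≤ n, PowerSeries.coeff k G
      = PowerSeries.coeff k (∑ j ∈ Finset.range (n + 1), PowerSeries.C (g j) * PowerSeries.X ^ q ^ j)) :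
    T ^ (n + 1) ∣ PowerSeries.coeff (n - 1) B - η' ^ n := by
  choose h hh using hg
  set ε := 1 - ∑ j ∈ Finset.range (n + 1), g j * η ^ q ^ j with hε
  set Gn : PowerSeries A := ∑ j ∈ Finset.range (n + 1), PowerSeries.C (g j) * PowerSeries.X ^ q ^ j
  -- The substitution `x ↦ T x` sends `T η - x` to `T y`. Defining `s` and `v` before this
  -- substitution makes the factor `T^k` at `x^k` visible. The exponent is nonnegative because `q ≥
  -- 2`.
  let s : PowerSeries A := ∑ j ∈ Finset.range n,
    PowerSeries.C (h j) * (PowerSeries.C (T * η) - PowerSeries.X) ^ (q ^ (j + 1) - 2)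
  obtain ⟨v, hv⟩ : ∃ v,
      (1 + PowerSeries.C T * (PowerSeries.C (T * η) - PowerSeries.X) * s) * v = 1 := by
    refine IsUnit.exists_right_inv ?_
    rw [PowerSeries.isUnit_iff_constantCoeff]
    simpa [mul_assoc] using hT _
  let y : PowerSeries A := PowerSeries.C η - PowerSeries.X
  let S := PowerSeries.rescale T s
  let V := PowerSeries.rescale T v
  have hC : ∀ a : A, PowerSeries.rescale T (PowerSeries.C a) = PowerSeries.C a := fun a => by
    ext k
    rw [PowerSeries.coeff_rescale, PowerSeries.coeff_C]
    split_ifs with hk <;> simp [hk]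
  have hy : PowerSeries.rescale T (PowerSeries.C (T * η) - PowerSeries.X) = PowerSeries.C T * y := by
    rw [map_sub, hC, PowerSeries.rescale_X, map_mul]
    ring
  have hV : (1 + PowerSeries.C T ^ 2 * y * S) * V = 1 := by
    have := congr(PowerSeries.rescale T $hv)
    rw [map_mul, map_one, map_add, map_mul, map_mul, hC, hy, map_one] at this
    linear_combination this
  have hS : PowerSeries.C T ^ 2 * y ^ 2 * S = ∑ j ∈ Finset.range n,
      PowerSeries.C (g (j + 1)) * y ^ q ^ (j + 1) := by
    simp only [S, s]
    rw [map_sum, Finset.mul_sum]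
    refine Finset.sum_congr rfl fun j _ => ?_
    rw [map_mul, map_pow, hy, hC, hh, map_mul, map_pow]
    have : q ^ (j + 1) = 2 + (q ^ (j + 1) - 2) := by
      have := Nat.le_self_pow (n := j + 1) (by omega) q
      omega
    generalize q ^ (j + 1) - 2 = k at *
    rw [this]
    ring_nf
  have hfac : 1 - Gn = y * (1 + PowerSeries.C T ^ 2 * y * S) + PowerSeries.C ε := by
    have h1 : ∀ j, PowerSeries.C (g j) * y ^ q ^ j
        = PowerSeries.C (g j * η ^ q ^ j) - PowerSeries.C (g j) * PowerSeries.X ^ q ^ j := fun j => by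
      rw [sub_pow_qpow hq, mul_sub, map_mul, map_pow]
    have h2 : ∑ j ∈ Finset.range (n + 1), PowerSeries.C (g j) * y ^ q ^ j
        = PowerSeries.C (1 - ε) - Gn := by
      rw [Finset.sum_congr rfl fun j _ => h1 j, Finset.sum_sub_distrib, hε, sub_sub_cancel, map_sum]
    rw [Finset.sum_range_succ', ← hS, hg0, map_one, pow_zero, pow_one, map_sub, map_one] at h2
    linear_combination -h2
  let W : PowerSeries A := PowerSeries.mk fun k => η' ^ (k + 1)
  have hW : y * W = 1 := by
    ext k
    rw [sub_mul, map_sub, PowerSeries.coeff_C_mul, PowerSeries.coeff_mk]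
    cases k with
    | zero => simp [hη]
    | succ k =>
      rw [PowerSeries.coeff_succ_X_mul, PowerSeries.coeff_mk, PowerSeries.coeff_one,
        if_neg (by omega), pow_succ' η' (k + 1), ← mul_assoc, hη, one_mul, sub_self]
  -- Three errors: the higher terms of the additive series, the defect `ε` of the root, and the
  -- truncation of `G`, which does not reach degree `n`.
  have hB : B - W = -(PowerSeries.C (T ^ 2) * PowerSeries.rescale T (s * v))
      - PowerSeries.C ε * (W * V * B) + (G - Gn) * (W * V * B) := by
    have h3 : y * (1 + PowerSeries.C T ^ 2 * y * S) * B
      = 1 - (PowerSeries.C ε - (G - Gn)) * B := by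
      linear_combination hGB - B * hfac
    rw [map_mul, map_pow]
    change B - W = -(PowerSeries.C T ^ 2 * (S * V)) - _ + _
    linear_combination (W * V) * h3 - B * hV
      - (B * (1 + PowerSeries.C T ^ 2 * y * S) * V) * hW
      + W * hV - PowerSeries.C T ^ 2 * S * V * hW
  have hcoeff : PowerSeries.coeff (n - 1) B - η' ^ n = PowerSeries.coeff (n - 1) (B - W) := by
    rw [map_sub, PowerSeries.coeff_mk, Nat.sub_add_cancel hn]
  rw [hcoeff, hB, map_add, coeff_mul_eq_zero_of_coeff_eq_zero (n := n) _ (by omega), add_zero,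
    map_sub, map_neg, PowerSeries.coeff_C_mul, PowerSeries.coeff_C_mul, PowerSeries.coeff_rescale]
  · refine dvd_sub ((dvd_neg).mpr ?_) (hroot.mul_right _)
    rw [← mul_assoc, ← pow_add, show 2 + (n - 1) = n + 1 by omega]
    exact dvd_mul_right _ _
  · intro i hi
    rw [map_sub, hG i hi, sub_self]

/-! ### Comparison of `α_n / Γ_n` with `η^{-n}` -/

section Comparison

variable {K : Type*} [Field K] {p f q : ℕ} [ExpChar K p] {θ : K}

theorem constantCoeff_eta (hq2 : 2 ≤ q) (θ : K) : PowerSeries.constantCoeff (eta q θ) = 1 := by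
  rw [← PowerSeries.coeff_zero_eq_constantCoeff_apply, coeff_eta q θ hq2 le_rfl]
  simp [etaPartial]

theorem X_pow_dvd_eta_sub_etaPartial (hq2 : 2 ≤ q) (θ : K) (l : ℕ) :
    PowerSeries.X ^ (l + 1) ∣ eta q θ - etaPartial q θ l := by
  rw [PowerSeries.X_pow_dvd_iff]
  intro m hm
  rw [map_sub, coeff_eta q θ hq2 (by omega : m ≤ l), sub_self]

/-- The last factor of the product is `θ^{q^{i+1}} - t^{q^{i+1}} = -(t - θ)^{q^{i+1}}`. -/
theorem X_pow_dvd_expandAt_gammaPoly (hq : q = p ^ f) (θ : K) (i : ℕ) :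
    PowerSeries.X ^ q ^ (i + 1) ∣ expandAt θ (gammaPoly q θ (i + 1)) := by
  rw [expandAt_gammaPoly, Finset.prod_range_succ, add_pow_qpow hq]
  refine Dvd.dvd.mul_left ⟨-1, ?_⟩ _
  rw [map_pow]
  ring

theorem coeff_map_gammaSeries (hq2 : 2 ≤ q) {n k : ℕ} (hk : k ≤ n) :
    PowerSeries.coeff k (PowerSeries.map (expandAt θ) (gammaSeries q θ))
      = PowerSeries.coeff k (∑ j ∈ Finset.range (n + 1), PowerSeries.C
          (PowerSeries.C (carlitzD q θ j)⁻¹ * expandAt θ (gammaPoly q θ j))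
          * PowerSeries.X ^ q ^ j) := by
  rw [PowerSeries.coeff_map, gammaSeries, PowerSeries.coeff_mk, map_sum, map_sum]
  rw [← Finset.sum_subset (Finset.range_mono (by omega : k + 1 ≤ n + 1))]
  · refine Finset.sum_congr rfl fun j _ => ?_
    rw [PowerSeries.coeff_C_mul, PowerSeries.coeff_X_pow]
    split_ifs with h1 h2 h2
    · rw [mul_one, map_mul]
      simp [expandAt]
    · exact absurd h1.symm h2
    · exact absurd h2.symm h1
    · simp
  · intro j _ hj
    rw [PowerSeries.coeff_C_mul, PowerSeries.coeff_X_pow, if_neg, mul_zero]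
    have := Nat.lt_pow_self (n := j) (a := q) (by omega)
    rw [Finset.mem_range] at hj
    omega

theorem carlitzGamma_ne_zero (hq : q = p ^ f) (hθ : ∀ m, θ ^ q ^ (m + 1) - θ ≠ 0) (n : ℕ) :
    carlitzGamma q θ n ≠ 0 :=
  Finset.prod_ne_zero_iff.mpr fun _ _ => pow_ne_zero _ <| Finset.prod_ne_zero_iff.mpr fun _ hk =>
    qpow_sub_ne_zero hq hθ (Finset.mem_range.mp hk).ne'

/-- `α_n / Γ_n` and `η^{-n}` agree modulo `(t - θ)^{n+1}`. -/
theorem coeff_expandAt_andersonThakurQuot (hq : q = p ^ f) (hq2 : 2 ≤ q)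
    (hθ : ∀ m, θ ^ q ^ (m + 1) - θ ≠ 0) {n m : ℕ} (hn : 1 ≤ n) (hm : m ≤ n) :
    PowerSeries.coeff m (expandAt θ (andersonThakurQuot q θ n))
      = PowerSeries.coeff m (eta q θ ^ n)⁻¹ := by
  have hη0 : PowerSeries.constantCoeff (eta q θ) ≠ 0 := by
    rw [constantCoeff_eta hq2]
    exact one_ne_zero
  have hquot : andersonThakurQuot q θ n
      = PowerSeries.coeff (n - 1) (PowerSeries.invOfUnit (1 - gammaSeries q θ) 1) := by
    rw [andersonThakurQuot, andersonThakur, ← mul_assoc, ← map_mul,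
      inv_mul_cancel₀ (carlitzGamma_ne_zero hq hθ n), map_one, one_mul]
  have : ExpChar (PowerSeries (PowerSeries K)) p :=
    expChar_of_injective_ringHom (f := PowerSeries.C) PowerSeries.C_injective p
  have key := pow_dvd_coeff_inverse_sub (A := PowerSeries K) hq hq2 (T := PowerSeries.X)
    (η := eta q θ) (η' := (eta q θ)⁻¹)
    (fun a => by rw [PowerSeries.isUnit_iff_constantCoeff]; simp)
    (PowerSeries.mul_inv_cancel _ hη0)
    (g := fun j => PowerSeries.C (carlitzD q θ j)⁻¹ * expandAt θ (gammaPoly q θ j))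
    (by simp [carlitzD, gammaPoly]) (fun j => (X_pow_dvd_expandAt_gammaPoly hq θ j).mul_left _)
    hn ?_ (G := PowerSeries.map (expandAt θ) (gammaSeries q θ))
    (B := PowerSeries.map (expandAt θ) (PowerSeries.invOfUnit (1 - gammaSeries q θ) 1)) ?_
    (fun k hk => coeff_map_gammaSeries hq2 hk)
  · rw [PowerSeries.coeff_map, ← hquot] at key
    have hpow : ((eta q θ)⁻¹) ^ n = (eta q θ ^ n)⁻¹ := by
      rw [PowerSeries.eq_inv_iff_mul_eq_one (by rw [map_pow]; exact pow_ne_zero _ hη0), ← mul_pow,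
        PowerSeries.inv_mul_cancel _ hη0, one_pow]
    rw [hpow, PowerSeries.X_pow_dvd_iff] at key
    have := key m (by omega)
    rwa [map_sub, sub_eq_zero] at this
  -- Subtracting the interpolation identity with `l = n` leaves terms in `(η_{n-i} - η)^{q^i}`,
  -- divisible by `T^{(n-i+1) q^i}`. Since `q^i ≥ i + 1`, this exponent is at least `n + 1`.
  · rw [← sum_expandAt_gammaPoly_mul hq hθ n, ← Finset.sum_sub_distrib]
    refine Finset.dvd_sum fun i hi => ?_
    rw [← mul_sub]
    refine Dvd.dvd.mul_left ?_ _
    rw [← sub_pow_qpow hq, ← neg_sub]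
    have h1 := pow_dvd_pow_of_dvd ((dvd_neg).mpr (X_pow_dvd_eta_sub_etaPartial hq2 θ (n - i)))
      (q ^ i)
    refine dvd_trans ?_ h1
    rw [← pow_mul]
    refine pow_dvd_pow _ ?_
    have h2 := Nat.lt_pow_self (n := i) (a := q) (by omega)
    rw [Finset.mem_range] at hi
    calc n + 1 ≤ (n - i) + 1 + i * 1 := by omega
      _ ≤ (n - i + 1) * 1 + (n - i + 1) * i := by
          rw [mul_one, mul_one]
          exact Nat.add_le_add_left (Nat.le_mul_of_pos_left _ (by omega)) _
      _ = (n - i + 1) * (i + 1) := by ring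
      _ ≤ _ := Nat.mul_le_mul_left _ h2
  · have h1 := congr(PowerSeries.map (expandAt θ) $(one_sub_gammaSeries_mul q θ))
    rwa [map_mul, map_sub, map_one] at h1

end Comparison

/-! ### The Taylor homomorphism `θ ↦ θ + X` on power series in `t - θ` -/

section Translate

variable {K : Type*} [Field K] (D : K →+* PowerSeries K)

/-- The coefficient of `X^j` of `∑ D(a_m) (-X)^m`. -/
def translateCoeff (j : ℕ) (a : PowerSeries K) : K :=
  ∑ i ∈ Finset.range (j + 1), (-1) ^ i * PowerSeries.coeff (j - i) (D (PowerSeries.coeff i a))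

/-- The homomorphism `p ↦ ∑ D(p_m) (-X)^m` on polynomials. -/
def translatePoly : Polynomial K →+* PowerSeries K := Polynomial.eval₂RingHom D (-PowerSeries.X)

theorem coeff_translatePoly (j : ℕ) (a : Polynomial K) :
    PowerSeries.coeff j (translatePoly D a) = translateCoeff D j a := by
  rw [translatePoly, Polynomial.coe_eval₂RingHom, Polynomial.eval₂_eq_sum_range' D
    (Nat.lt_succ_of_le (le_max_left a.natDegree j)), map_sum, translateCoeff,
    ← Finset.sum_subset (Finset.range_mono (by omega : j + 1 ≤ (max a.natDegree j).succ))]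
  · refine Finset.sum_congr rfl fun i hi => ?_
    rw [neg_pow, mul_left_comm, ← map_one PowerSeries.C, ← map_neg, ← map_pow,
      PowerSeries.coeff_C_mul, PowerSeries.coeff_mul_X_pow', if_pos (by simpa [Nat.lt_succ_iff] using hi),
      Polynomial.coeff_coe]
  · intro i _ hi
    rw [neg_pow, mul_left_comm, ← map_one PowerSeries.C, ← map_neg, ← map_pow,
      PowerSeries.coeff_C_mul, PowerSeries.coeff_mul_X_pow', if_neg (by simpa [Nat.lt_succ_iff] using hi),
      mul_zero]

theorem translateCoeff_congr {j : ℕ} {a b : PowerSeries K}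
    (h : ∀ i ≤ j, PowerSeries.coeff i a = PowerSeries.coeff i b) :
    translateCoeff D j a = translateCoeff D j b :=
  Finset.sum_congr rfl fun i hi => by rw [h i (by simpa [Nat.lt_succ_iff] using hi)]

theorem translateCoeff_eq_coeff_translatePoly_trunc {j l : ℕ} (h : j ≤ l) (a : PowerSeries K) :
    translateCoeff D j a = PowerSeries.coeff j (translatePoly D (PowerSeries.trunc (l + 1) a)) := by
  rw [coeff_translatePoly]
  refine translateCoeff_congr D fun i hi => ?_
  rw [Polynomial.coeff_coe, PowerSeries.coeff_trunc, if_pos (by omega)]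

/-- The homomorphism `∑ a_m T^m ↦ ∑ D(a_m) (-X)^m` on power series. -/
def translate : PowerSeries K →+* PowerSeries K where
  toFun a := PowerSeries.mk fun j => translateCoeff D j a
  map_one' := by
    ext j
    rw [PowerSeries.coeff_mk, ← Polynomial.coe_one, ← coeff_translatePoly, map_one, Polynomial.coe_one]
  map_zero' := by
    ext j
    rw [PowerSeries.coeff_mk, ← Polynomial.coe_zero, ← coeff_translatePoly, map_zero, Polynomial.coe_zero]
  map_add' a b := by
    ext j
    simp [translateCoeff, mul_add, Finset.sum_add_distrib]
  map_mul' a b := by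
    ext j
    -- Only coefficients up to `j` matter, so multiplicativity reduces to polynomials, where the map
    -- is an evaluation.
    have h : translateCoeff D j (a * b) = PowerSeries.coeff j
        (translatePoly D (PowerSeries.trunc (j + 1) a * PowerSeries.trunc (j + 1) b)) := by
      rw [coeff_translatePoly]
      refine translateCoeff_congr D fun i hi => ?_
      rw [Polynomial.coe_mul, PowerSeries.coeff_mul, PowerSeries.coeff_mul]
      refine Finset.sum_congr rfl fun x hx => ?_
      have h1 := Finset.HasAntidiagonal.antidiagonal.fst_le hx
      have h2 := Finset.HasAntidiagonal.antidiagonal.snd_le hx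
      rw [Polynomial.coeff_coe, Polynomial.coeff_coe, PowerSeries.coeff_trunc,
        PowerSeries.coeff_trunc, if_pos (by omega), if_pos (by omega)]
    rw [PowerSeries.coeff_mk, h, map_mul, PowerSeries.coeff_mul, PowerSeries.coeff_mul]
    refine Finset.sum_congr rfl fun x hx => ?_
    have h1 := Finset.HasAntidiagonal.antidiagonal.fst_le hx
    have h2 := Finset.HasAntidiagonal.antidiagonal.snd_le hx
    rw [PowerSeries.coeff_mk, PowerSeries.coeff_mk,
      translateCoeff_eq_coeff_translatePoly_trunc D h1,
      translateCoeff_eq_coeff_translatePoly_trunc D h2]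

theorem coeff_translate (j : ℕ) (a : PowerSeries K) :
    PowerSeries.coeff j (translate D a) = translateCoeff D j a := by
  simp [translate]

theorem translate_coe (a : Polynomial K) : translate D a = translatePoly D a := by
  ext j
  rw [coeff_translate, coeff_translatePoly]

theorem translate_C (a : K) : translate D (PowerSeries.C a) = D a := by
  rw [← Polynomial.coe_C, translate_coe, translatePoly, Polynomial.coe_eval₂RingHom,
    Polynomial.eval₂_C]

theorem translate_X : translate D PowerSeries.X = -PowerSeries.X := by
  rw [← Polynomial.coe_X, translate_coe, translatePoly, Polynomial.coe_eval₂RingHom,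
    Polynomial.eval₂_X, Polynomial.coe_X]

theorem coeff_translate_congr {j : ℕ} {a b : PowerSeries K}
    (h : ∀ i ≤ j, PowerSeries.coeff i a = PowerSeries.coeff i b) :
    PowerSeries.coeff j (translate D a) = PowerSeries.coeff j (translate D b) := by
  rw [coeff_translate, coeff_translate, translateCoeff_congr D h]

/-- The polynomial variable `t = (t - θ) + θ` goes to `-X + (θ + X) = θ`. So the `t`-linear
hyperderivative evaluated at `t = θ` agrees with the one on series in `t - θ`. -/
theorem translate_expandAt {θ : K} (hθ : D θ = PowerSeries.C θ + PowerSeries.X)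
    (a : Polynomial K) : translate D (expandAt θ a) = a.eval₂ D (PowerSeries.C θ) := by
  rw [expandAt, Polynomial.coe_eval₂RingHom, Polynomial.hom_eval₂]
  congr 1
  · ext1 x
    exact translate_C D x
  · rw [map_add, translate_X, translate_C, hθ]
    ring

end Translate

/-! ### Hyperderivatives as coefficients of the translation -/

section Hyperderiv

variable {F : Type*} [Field F] {L : Type*} [Field L] [Algebra F⸨X⸩ L]

theorem constantCoeff_hyperderivSeries (j : ℕ) (a : PowerSeries (KSep F L)) :
    PowerSeries.constantCoeff (hyperderivSeries F L j a)
      = PowerSeries.coeff j (translate (taylorSep F L) a) := by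
  rw [coeff_translate, translateCoeff, hyperderivSeries,
    ← PowerSeries.coeff_zero_eq_constantCoeff_apply, PowerSeries.coeff_mk]
  simp [hyperderiv]

theorem eval_hyperderivPoly (j : ℕ) (a : Polynomial (KSep F L)) (x : KSep F L) :
    (hyperderivPoly F L j a).eval x
      = PowerSeries.coeff j (a.eval₂ (taylorSep F L) (PowerSeries.C x)) := by
  rw [hyperderivPoly, Polynomial.eval₂_def, Polynomial.sum, Polynomial.sum,
    Polynomial.eval_finsetSum, map_sum]
  refine Finset.sum_congr rfl fun i _ => ?_
  rw [Polynomial.eval_monomial, ← map_pow, PowerSeries.coeff_mul_C, hyperderiv]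

theorem coeff_taylorInf (j : ℕ) (x : F⸨X⸩) :
    PowerSeries.coeff j (taylorInf F x) = hyperderivInf j x := by
  simp [taylorInf]

theorem taylorInf_theta :
    taylorInf F (thetaInf F) = PowerSeries.C (thetaInf F) + PowerSeries.X := by
  ext j k
  rw [coeff_taylorInf, hyperderivInf_coeff, thetaInf, HahnSeries.coeff_single, map_add, PowerSeries.coeff_C,
    PowerSeries.coeff_X, HahnSeries.coeff_add]
  by_cases h : k - j = -1
  · rw [if_pos h, show (j : ℤ) - k = (1 : ℕ) by push_cast; omega, Ring.choose_natCast]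
    rcases j with _ | _ | j
    · have : k = -1 := by simpa using h
      simp [this]
    · have : k = 0 := by simpa using h
      simp [this]
    · simp [Nat.choose_eq_zero_of_lt (show 1 < j + 1 + 1 by omega)]
  · rw [if_neg h, smul_zero]
    rcases j with _ | _ | j
    · have : k ≠ -1 := by simpa using h
      simp [HahnSeries.coeff_single_of_ne this]
    · have : k ≠ 0 := by simpa [sub_eq_iff_eq_add] using h
      simp [HahnSeries.coeff_one, this]
    · simp

theorem taylorSep_theta :
    taylorSep F L (thetaSep F L) = PowerSeries.C (thetaSep F L) + PowerSeries.X := by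
  rw [thetaSep, (taylorSep_spec F L).2, taylorInf_theta, map_add, PowerSeries.map_C,
    PowerSeries.map_X]

theorem eval_hyperderivPoly_theta (j : ℕ) (a : Polynomial (KSep F L)) :
    (hyperderivPoly F L j a).eval (thetaSep F L)
      = PowerSeries.coeff j (translate (taylorSep F L) (expandAt (thetaSep F L) a)) := by
  rw [eval_hyperderivPoly, translate_expandAt _ taylorSep_theta]

theorem thetaInf_pow (k : ℕ) : thetaInf F ^ k = HahnSeries.single (-(k : ℤ)) 1 := by
  rw [thetaInf, HahnSeries.single_pow]
  simp

theorem thetaInf_pow_injective : Function.Injective fun k : ℕ => thetaInf F ^ k := by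
  intro a b h
  have h1 := congr(HahnSeries.order $h)
  simp only [thetaInf_pow] at h1
  rw [HahnSeries.order_single one_ne_zero, HahnSeries.order_single one_ne_zero] at h1
  omega

theorem thetaInf_qpow_sub_ne_zero {q : ℕ} (hq2 : 2 ≤ q) (m : ℕ) :
    thetaInf F ^ q ^ (m + 1) - thetaInf F ≠ 0 := by
  rw [sub_ne_zero]
  intro h
  have h1 := thetaInf_pow_injective (F := F) (h.trans (pow_one _).symm)
  have := Nat.lt_pow_self (n := m + 1) (a := q) (by omega)
  omega

theorem thetaSep_qpow_sub_ne_zero {q : ℕ} (hq2 : 2 ≤ q) (m : ℕ) :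
    thetaSep F L ^ q ^ (m + 1) - thetaSep F L ≠ 0 := by
  rw [thetaSep, ← map_pow, ← map_sub]
  exact (map_ne_zero _).mpr (thetaInf_qpow_sub_ne_zero hq2 m)

/-- The hyperderivatives of `η^{-n}` and of `α_n / Γ_n` at `t = θ` agree up to order `n`. -/
theorem hyperderiv_eta_inv_eq {p f q : ℕ} [ExpChar (KSep F L) p] (hq : q = p ^ f) (hq2 : 2 ≤ q)
    {n j : ℕ} (hn : 1 ≤ n) (hj : j ≤ n) :
    PowerSeries.constantCoeff (hyperderivSeries F L j (eta q (thetaSep F L) ^ n)⁻¹)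
      = (hyperderivPoly F L j (andersonThakurQuot q (thetaSep F L) n)).eval (thetaSep F L) := by
  rw [constantCoeff_hyperderivSeries, eval_hyperderivPoly_theta]
  exact coeff_translate_congr _ fun i hi => (coeff_expandAt_andersonThakurQuot hq hq2
    (thetaSep_qpow_sub_ne_zero hq2) hn (hi.trans hj)).symm

end Hyperderiv

/-! ### Residues of products of negative powers of linear factors -/

section Residue

variable {k : Type*} [Field k]

/-- The subring of power series in the field of Laurent series. -/
def integralPart (k : Type*) [Field k] : Subring k⸨X⸩ := (HahnSeries.ofPowerSeries ℤ k).range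

theorem coeff_eq_zero_of_mem_integralPart {x : k⸨X⸩} (hx : x ∈ integralPart k) {i : ℤ}
    (hi : i < 0) : x.coeff i = 0 := by
  obtain ⟨y, rfl⟩ := hx
  rw [PowerSeries.coeff_coe, if_pos hi]

/-- The Laurent series `x + c`. -/
def linFactor (c : k) : k⸨X⸩ := HahnSeries.single 1 1 + HahnSeries.C c

theorem linFactor_eq_coe (c : k) :
    linFactor c = HahnSeries.ofPowerSeries ℤ k (PowerSeries.X + PowerSeries.C c) := by
  rw [map_add, HahnSeries.ofPowerSeries_X, HahnSeries.ofPowerSeries_C, linFactor]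

theorem linFactor_zero : linFactor (0 : k) = HahnSeries.single 1 1 := by
  rw [linFactor, map_zero, add_zero]

theorem linFactor_ne_zero (c : k) : linFactor c ≠ 0 := by
  rw [linFactor_eq_coe, (map_ne_zero_iff _ HahnSeries.ofPowerSeries_injective)]
  intro h
  have := congr(PowerSeries.coeff 1 $h)
  simp at this

theorem linFactor_inv_eq_coe {c : k} (hc : c ≠ 0) :
    (linFactor c)⁻¹ = HahnSeries.ofPowerSeries ℤ k (PowerSeries.X + PowerSeries.C c)⁻¹ := by
  rw [linFactor_eq_coe]
  refine inv_eq_of_mul_eq_one_right ?_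
  rw [← map_mul, PowerSeries.mul_inv_cancel _ (by simpa using hc), map_one]

theorem linFactor_inv_mem {c : k} (hc : c ≠ 0) : (linFactor c)⁻¹ ∈ integralPart k :=
  ⟨_, (linFactor_inv_eq_coe hc).symm⟩

variable (a : ℕ → k) (s : Finset ℕ)

/-- The sum over `i ∈ s` of the residues at `a i` of `∏_{j ∈ s} (u - a j)^{-m j}`. -/
def residueSum (m : ℕ → ℕ) : k :=
  ∑ i ∈ s, (∏ j ∈ s, (linFactor (a i - a j))⁻¹ ^ m j : k⸨X⸩).coeff (-1)

variable {a s}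

theorem prod_pow_add_single {M : Type*} [CommMonoid M] (u : ℕ → M) (m : ℕ → ℕ) {i : ℕ}
    (hi : i ∈ s) : ∏ j ∈ s, u j ^ (m + Pi.single i 1 : ℕ → ℕ) j = (∏ j ∈ s, u j ^ m j) * u i := by
  simp only [Pi.add_apply, pow_add]
  rw [Finset.prod_mul_distrib, Finset.prod_eq_single (f := fun x => u x ^ (Pi.single i 1 : ℕ → ℕ) x)
    i (fun b _ hb => by rw [Pi.single_eq_of_ne hb, pow_zero]) (fun h => absurd hi h),
    Pi.single_eq_same, pow_one]

/-- Partial fractions: `(a_i - a_j)/((u - a_i)(u - a_j)) = 1/(u - a_i) - 1/(u - a_j)`. -/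
theorem sub_mul_residueSum (m : ℕ → ℕ) {i j : ℕ} (hi : i ∈ s) (hj : j ∈ s) :
    (a i - a j) * residueSum a s (m + Pi.single i 1 + Pi.single j 1)
      = residueSum a s (m + Pi.single i 1) - residueSum a s (m + Pi.single j 1) := by
  rw [residueSum, residueSum, residueSum, Finset.mul_sum, ← Finset.sum_sub_distrib]
  refine Finset.sum_congr rfl fun r _ => ?_
  rw [← HahnSeries.coeff_sub, ← smul_eq_mul, ← HahnSeries.coeff_smul, ← HahnSeries.C_mul_eq_smul,
    prod_pow_add_single _ _ hj, prod_pow_add_single _ _ hi, prod_pow_add_single _ _ hj]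
  congr 1
  have h1 := linFactor_ne_zero (a r - a i)
  have h2 := linFactor_ne_zero (a r - a j)
  have h3 : HahnSeries.C (a i - a j) = linFactor (a r - a j) - linFactor (a r - a i) := by
    simp only [linFactor, map_sub]
    ring
  rw [h3]
  field_simp

/-- The residue theorem on the projective line, by induction on the total pole order. With two
distinct poles, partial fractions give a difference of two sums of the same lower order, which have
equal values. With a single pole the sum is read off from a pure negative power. -/
theorem residueSum_eq (ha : Function.Injective a) (N : ℕ) (m : ℕ → ℕ)
    (hm : ∑ j ∈ s, m j = N + 1) : residueSum a s m = if N = 0 then 1 else 0 := by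
  induction N generalizing m with
  | zero => ?_
  | succ N ih => ?_
  all_goals
    obtain ⟨i, hi, hmi⟩ : ∃ i ∈ s, m i ≠ 0 := by
      by_contra! h
      rw [Finset.sum_eq_zero h] at hm
      omega
    by_cases h : ∃ j ∈ s, j ≠ i ∧ m j ≠ 0
  -- Total order one leaves no room for two distinct poles.
  · obtain ⟨j, hj, hji, hmj⟩ := h
    have := Finset.sum_le_sum_of_subset (f := m) (Finset.insert_subset hi
      (Finset.singleton_subset_iff.mpr hj))
    rw [Finset.sum_pair hji.symm] at this
    omega
  rotate_left
  · obtain ⟨j, hj, hji, hmj⟩ := h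
    obtain ⟨m', rfl⟩ : ∃ m' : ℕ → ℕ, m = m' + (Pi.single i 1 : ℕ → ℕ) + (Pi.single j 1 : ℕ → ℕ) := by
      refine ⟨fun r => if r = i then m i - 1 else if r = j then m j - 1 else m r, ?_⟩
      ext r
      rw [Pi.add_apply, Pi.add_apply, Pi.single_apply, Pi.single_apply]
      split_ifs <;> subst_vars <;> omega
    have hs : ∀ (m : ℕ → ℕ), ∀ i ∈ s,
        ∑ r ∈ s, (m + Pi.single i 1 : ℕ → ℕ) r = ∑ r ∈ s, m r + 1 := fun m i hi => by
      simp [Finset.sum_add_distrib, hi]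
    have hmi : ∑ r ∈ s, (m' + Pi.single i 1 : ℕ → ℕ) r = N + 1 := by
      have := hs (m' + Pi.single i 1) j hj
      omega
    have hmj : ∑ r ∈ s, (m' + Pi.single j 1 : ℕ → ℕ) r = N + 1 := by
      rw [hs _ _ hj, ← hs _ _ hi, hmi]
    have h1 := sub_mul_residueSum (a := a) m' hi hj
    rw [ih _ hmi, ih _ hmj, sub_self] at h1
    rw [if_neg (by omega)]
    exact (mul_eq_zero.mp h1).resolve_left (sub_ne_zero.mpr fun h => hji (ha h).symm)
  all_goals
    push Not at h
    have hmN : m i = ∑ j ∈ s, m j := (Finset.sum_eq_single_of_mem i hi h).symm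
    rw [hm] at hmN
    have hprod : ∀ r, ∏ j ∈ s, (linFactor (a r - a j))⁻¹ ^ m j
        = (linFactor (a r - a i))⁻¹ ^ m i := fun r =>
      Finset.prod_eq_single_of_mem i hi fun j hj hji => by rw [h j hj hji, pow_zero]
    rw [residueSum, Finset.sum_eq_single_of_mem i hi]
    · rw [hprod, hmN, sub_self, linFactor_zero, HahnSeries.inv_single, HahnSeries.single_pow,
        HahnSeries.coeff_single]
      simp
      try omega
    · intro r _ hr
      rw [hprod]
      exact coeff_eq_zero_of_mem_integralPart (pow_mem (linFactor_inv_mem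
        (sub_ne_zero.mpr fun h => hr (ha h))) _) (by norm_num)

theorem residueSum_eq_zero (ha : Function.Injective a) (m : ℕ → ℕ) (hm : 2 ≤ ∑ j ∈ s, m j) :
    residueSum a s m = 0 := by
  rw [residueSum_eq ha (∑ j ∈ s, m j - 1) m (by omega), if_neg (by omega)]

/-- The residue of a product with a power series only depends on the coefficients of the power
series below the order of the pole of the other factor. -/
theorem coeff_coe_mul_eq_sum (y : PowerSeries k) (h : k⸨X⸩) (n : ℕ)
    (hh : HahnSeries.single (n : ℤ) 1 * h ∈ integralPart k) :
    (HahnSeries.ofPowerSeries ℤ k y * h).coeff (-1)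
      = ∑ m ∈ Finset.range n, PowerSeries.coeff m y
          * (HahnSeries.single (m : ℤ) 1 * h).coeff (-1) := by
  obtain ⟨z, hz⟩ : PowerSeries.X ^ n ∣ y
      - ∑ m ∈ Finset.range n, PowerSeries.C (PowerSeries.coeff m y) * PowerSeries.X ^ m := by
    rw [PowerSeries.X_pow_dvd_iff]
    intro m hm
    simp [PowerSeries.coeff_X_pow, hm]
  have hy := eq_add_of_sub_eq' hz
  have hX : ∀ m : ℕ, HahnSeries.ofPowerSeries ℤ k (PowerSeries.X ^ m)
      = HahnSeries.single (m : ℤ) 1 := fun m => by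
    rw [map_pow, HahnSeries.ofPowerSeries_X, HahnSeries.single_pow]
    simp
  conv_lhs => rw [hy]
  rw [map_add, add_mul, HahnSeries.coeff_add, map_mul _ _ z, hX, mul_right_comm,
    coeff_eq_zero_of_mem_integralPart (mul_mem hh ⟨z, rfl⟩) (by norm_num), add_zero, map_sum,
    Finset.sum_mul, HahnSeries.coeff_sum]
  refine Finset.sum_congr rfl fun m _ => ?_
  rw [map_mul, hX, HahnSeries.ofPowerSeries_C, mul_assoc, HahnSeries.C_mul_eq_smul,
    HahnSeries.coeff_smul, smul_eq_mul]

/-- The action of a ring endomorphism of the coefficients on Laurent series. -/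
def mapLaurent (φ : k →+* k) : k⸨X⸩ →+* k⸨X⸩ where
  toFun x := x.map φ
  map_one' := by
    have := HahnSeries.map_C (Γ := ℤ) 1 φ
    rwa [map_one, map_one, map_one] at this
  map_zero' := by
    have := HahnSeries.map_C (Γ := ℤ) 0 φ
    rwa [map_zero, map_zero, map_zero] at this
  map_add' x y := by
    ext i
    simp
  map_mul' x y := HahnSeries.map_mul (φ : k →ₙ+* k)

theorem coeff_mapLaurent (φ : k →+* k) (x : k⸨X⸩) (i : ℤ) :
    (mapLaurent φ x).coeff i = φ (x.coeff i) := rfl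

theorem mapLaurent_single (φ : k →+* k) (i : ℤ) :
    mapLaurent φ (HahnSeries.single i 1) = HahnSeries.single i 1 := by
  ext j
  rw [coeff_mapLaurent, HahnSeries.coeff_single]
  split_ifs <;> simp

theorem mapLaurent_linFactor (φ : k →+* k) (c : k) :
    mapLaurent φ (linFactor c) = linFactor (φ c) := by
  rw [linFactor, map_add, mapLaurent_single, linFactor]
  congr 1
  exact HahnSeries.map_C c φ

theorem mapLaurent_coe (φ : k →+* k) (y : PowerSeries k) :
    mapLaurent φ (HahnSeries.ofPowerSeries ℤ k y)
      = HahnSeries.ofPowerSeries ℤ k (PowerSeries.map φ y) := by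
  ext i
  rw [coeff_mapLaurent, PowerSeries.coeff_coe, PowerSeries.coeff_coe, PowerSeries.coeff_map]
  split_ifs <;> simp

end Residue

/-! ### The exponential coefficients as residues -/

section Matrices

variable {k : Type*} [Field k] {n : ℕ}

theorem mul_shiftN_apply (φ : ℕ → ℕ → k) (r c : Fin n) :
    (Matrix.of (fun i j : Fin n => φ i j) * shiftN k n) r c
      = if 0 < c.val then φ r (c - 1) else 0 := by
  rw [Matrix.mul_apply]
  split_ifs with h
  · rw [Finset.sum_eq_single ⟨c.val - 1, by omega⟩]
    · simp [shiftN, Nat.sub_add_cancel h]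
    · intro b _ hb
      have : b.val + 1 ≠ c.val := fun h' => hb (Fin.ext (by simp; omega))
      simp [shiftN, this]
    · simp
  · refine Finset.sum_eq_zero fun b _ => ?_
    simp [shiftN, show b.val + 1 ≠ c.val by omega]

theorem shiftN_mul_apply (φ : ℕ → ℕ → k) (r c : Fin n) :
    (shiftN k n * Matrix.of (fun i j : Fin n => φ i j)) r c
      = if r.val + 1 < n then φ (r + 1) c else 0 := by
  rw [Matrix.mul_apply]
  split_ifs with h
  · rw [Finset.sum_eq_single ⟨r.val + 1, h⟩]
    · simp [shiftN]
    · intro b _ hb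
      have : r.val + 1 ≠ b.val := fun h' => hb (Fin.ext (by simp; omega))
      simp [shiftN, this]
    · simp
  · refine Finset.sum_eq_zero fun b _ => ?_
    simp [shiftN, show r.val + 1 ≠ b.val by omega]

theorem cornerE_mul_apply (φ : ℕ → ℕ → k) (r c : Fin n) :
    (cornerE k n * Matrix.of (fun i j : Fin n => φ i j)) r c
      = if r.val + 1 = n then φ 0 c else 0 := by
  rw [Matrix.mul_apply, Finset.sum_eq_single ⟨0, r.pos⟩]
  · simp [cornerE]
  · intro b _ hb
    have : b.val ≠ 0 := fun h' => hb (Fin.ext h')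
    simp [cornerE, this]
  · simp

/-- Such a `D` would be an eigenvector of the nilpotent operator `M ↦ M N - N M` with eigenvalue `a
- b ≠ 0`. This gives uniqueness in the recursion for the `Q_i`. -/
theorem eq_zero_of_mul_lieTheta_eq {a b : k} (hab : b - a ≠ 0) {D : Matrix (Fin n) (Fin n) k}
    (hD : D * lieTheta b n = lieTheta a n * D) : D = 0 := by
  have h1 : adN n D = (-(b - a)) • D := by
    simp only [lieTheta, mul_add, add_mul, Matrix.mul_smul, Matrix.smul_mul, mul_one, one_mul] at hD
    rw [adN, neg_smul, sub_smul, sub_eq_iff_eq_add, neg_sub]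
    rw [← sub_eq_zero] at hD ⊢
    rw [← hD]
    abel
  have h2 : ∀ (c : k) (M : Matrix (Fin n) (Fin n) k), adN n (c • M) = c • adN n M := fun c M => by
    rw [adN, adN, Matrix.smul_mul, Matrix.mul_smul, smul_sub]
  have h3 : ∀ m, (adN n)^[m] D = (-(b - a)) ^ m • D := fun m => by
    induction m with
    | zero => simp
    | succ m ih => rw [Function.iterate_succ_apply', ih, h2, h1, smul_smul, pow_succ]
  have h4 := adN_iterate n D
  rw [h3] at h4
  exact (smul_eq_zero.mp h4).resolve_left (pow_ne_zero _ (neg_ne_zero.mpr hab))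

end Matrices

section ExpCoeff

variable {k : Type*} [Field k] {p f q : ℕ} [ExpChar k p] {θ : k}

/-- The Laurent series at `u = θ^{q^i}` of `(u - θ)^{-e} ∏_{j=1}^l (u - θ^{q^j})^{-n}`. -/
def poleFactor (q : ℕ) (θ : k) (n l i e : ℕ) : k⸨X⸩ :=
  (linFactor (θ ^ q ^ i - θ))⁻¹ ^ e
    * ∏ j ∈ Finset.range l, (linFactor (θ ^ q ^ i - θ ^ q ^ (j + 1)))⁻¹ ^ n

/-- The residue of `(u - θ^{q^i})^m (u - θ)^{-e} ∏_{j=1}^i (u - θ^{q^j})^{-n}`. -/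
def expResidue (q : ℕ) (θ : k) (n i e m : ℕ) : k :=
  (HahnSeries.single (m : ℤ) 1 * poleFactor q θ n i i e).coeff (-1)

theorem single_natCast_eq_pow (m : ℕ) :
    (HahnSeries.single (m : ℤ) 1 : k⸨X⸩) = linFactor 0 ^ m := by
  rw [linFactor_zero, HahnSeries.single_pow]
  simp

theorem expResidue_zero (q : ℕ) (θ : k) {n e m : ℕ} :
    expResidue q θ n 0 e m = if m + 1 = e then 1 else 0 := by
  rw [expResidue, poleFactor, pow_zero, pow_one, sub_self, Finset.prod_range_zero, mul_one,
    linFactor_zero, HahnSeries.inv_single, HahnSeries.single_pow, HahnSeries.single_mul_single,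
    HahnSeries.coeff_single]
  simp only [smul_neg, nsmul_eq_mul, mul_one, inv_one, one_pow]
  congr 1
  rw [eq_iff_iff]
  omega

/-- Multiply the integrand by `u - θ = (u - θ^{q^i}) + (θ^{q^i} - θ)`. -/
theorem expResidue_succ (q : ℕ) (θ : k) (n i e m : ℕ) :
    expResidue q θ n i e m
      = (θ ^ q ^ i - θ) * expResidue q θ n i (e + 1) m + expResidue q θ n i (e + 1) (m + 1) := by
  rw [expResidue, expResidue, expResidue, ← smul_eq_mul (θ ^ q ^ i - θ), ← HahnSeries.coeff_smul,
    ← HahnSeries.coeff_add, ← HahnSeries.C_mul_eq_smul]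
  congr 1
  have h := linFactor_ne_zero (θ ^ q ^ i - θ)
  have h1 : poleFactor q θ n i i e
      = linFactor (θ ^ q ^ i - θ) * poleFactor q θ n i i (e + 1) := by
    rw [poleFactor, poleFactor, pow_succ]
    field_simp
  rw [h1, linFactor, single_natCast_eq_pow, single_natCast_eq_pow, ← linFactor_zero, pow_succ]
  ring

/-- The pole at `u = θ^{q^i}` has order `e` if `i = 0`; otherwise it comes from the factor `j = i`
alone and has order `n`. -/
theorem single_mul_poleFactor_mem (hq : q = p ^ f) (hθ : ∀ m, θ ^ q ^ (m + 1) - θ ≠ 0)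
    (n i : ℕ) {e : ℕ} (he : e ≤ n) :
    HahnSeries.single (n : ℤ) 1 * poleFactor q θ n i i e ∈ integralPart k := by
  have hx : linFactor (0 : k) ∈ integralPart k := by
    rw [linFactor_eq_coe]
    exact ⟨_, rfl⟩
  have hx0 := linFactor_ne_zero (0 : k)
  rw [single_natCast_eq_pow, poleFactor]
  cases i with
  | zero =>
    rw [pow_zero, pow_one, sub_self, Finset.prod_range_zero, mul_one,
      show n = (n - e) + e by omega, pow_add, mul_assoc, ← mul_pow, mul_inv_cancel₀ hx0, one_pow,
      mul_one]
    exact pow_mem hx _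
  | succ i =>
    rw [Finset.prod_range_succ, sub_self, mul_left_comm, mul_left_comm (linFactor 0 ^ n), ← mul_pow,
      mul_inv_cancel₀ hx0, one_pow, mul_one]
    refine mul_mem (pow_mem (linFactor_inv_mem (hθ i)) _) (prod_mem fun j hj => ?_)
    refine pow_mem (linFactor_inv_mem (qpow_sub_ne_zero hq hθ ?_)) _
    have := Finset.mem_range.mp hj
    omega

theorem expResidue_self (hq : q = p ^ f) (hθ : ∀ m, θ ^ q ^ (m + 1) - θ ≠ 0)
    (n i : ℕ) {e : ℕ} (he : e ≤ n) : expResidue q θ n i e n = 0 :=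
  coeff_eq_zero_of_mem_integralPart (single_mul_poleFactor_mem hq hθ n i he) (by norm_num)

/-- `x ↦ x^{q^i}` is a ring endomorphism. -/
theorem exists_qpow_hom (hq : q = p ^ f) (i : ℕ) : ∃ φ : k →+* k, ∀ x, φ x = x ^ q ^ i :=
  ⟨iterateFrobenius k p (f * i), fun x => by rw [iterateFrobenius_def, hq, ← pow_mul]⟩

/-- Frobenius on coefficients moves every node `θ^{q^j}` to the next one. With `e = n` the factor at
`θ` becomes the missing factor at `θ^q`, and nothing remains at `θ` itself. -/
theorem expResidue_succ_zero (hq : q = p ^ f) (n i m : ℕ) :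
    expResidue q θ n (i + 1) 0 m = expResidue q θ n i n m ^ q := by
  obtain ⟨φ, hφ⟩ := exists_qpow_hom (k := k) hq 1
  simp only [pow_one] at hφ
  rw [← hφ, expResidue, expResidue, ← coeff_mapLaurent, map_mul, mapLaurent_single, poleFactor,
    poleFactor, map_mul, map_prod, pow_zero, one_mul, Finset.prod_range_succ']
  have h : ∀ j, φ (θ ^ q ^ i - θ ^ q ^ j) = θ ^ q ^ (i + 1) - θ ^ q ^ (j + 1) := fun j => by
    rw [map_sub, hφ, hφ, ← pow_mul, ← pow_mul, pow_succ, pow_succ]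
  have h0 := h 0
  rw [pow_zero, pow_one] at h0
  simp only [map_pow, map_inv₀, mapLaurent_linFactor, h, h0]
  rw [mul_comm (Finset.prod _ _)]

/-- The residues satisfy the recursion that characterises the `Q_i`: `expResidue_succ` is its
generic entry, and `expResidue_succ_zero` supplies the Frobenius term in the bottom row. -/
theorem expCoeff_eq (hq : q = p ^ f) (hθ : ∀ m, θ ^ q ^ (m + 1) - θ ≠ 0) (n i : ℕ) :
    expCoeff q θ n i = Matrix.of fun r c : Fin n =>
      expResidue q θ n i (n - (r : ℕ)) (n - 1 - (c : ℕ)) := by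
  induction i with
  | zero =>
    ext r c
    rw [Matrix.of_apply, expResidue_zero, expCoeff, Matrix.one_apply]
    congr 1
    rw [eq_iff_iff, Fin.ext_iff]
    omega
  | succ i ih =>
    rw [← sub_eq_zero]
    refine eq_zero_of_mul_lieTheta_eq (hθ i) ?_
    rw [sub_mul, mul_sub, expCoeff_succ q θ n i (hθ i), sub_eq_sub_iff_add_eq_add, add_assoc,
      add_right_inj, ih]
    have hmap : (Matrix.of fun r c : Fin n => expResidue q θ n i (n - (r : ℕ)) (n - 1 - (c : ℕ))).map
        (· ^ q) = Matrix.of fun r c : Fin n =>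
          expResidue q θ n i (n - (r : ℕ)) (n - 1 - (c : ℕ)) ^ q := rfl
    rw [hmap]
    ext r c
    simp only [lieTheta, mul_add, add_mul, Matrix.mul_smul, Matrix.smul_mul, mul_one, one_mul]
    rw [Matrix.add_apply, Matrix.add_apply, Matrix.add_apply,
      shiftN_mul_apply (fun r c => expResidue q θ n (i + 1) (n - r) (n - 1 - c)),
      mul_shiftN_apply (fun r c => expResidue q θ n (i + 1) (n - r) (n - 1 - c)),
      cornerE_mul_apply (fun r c => expResidue q θ n i (n - r) (n - 1 - c) ^ q)]
    simp only [Matrix.smul_apply, Matrix.of_apply, smul_eq_mul, tsub_zero,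
      ← expResidue_succ_zero hq]
    obtain ⟨e, he⟩ : ∃ e, n - (r : ℕ) = e + 1 := ⟨n - r - 1, by omega⟩
    have hrec := expResidue_succ q θ n (i + 1) e (n - 1 - c)
    have hR : (if r.val + 1 = n then expResidue q θ n (i + 1) 0 (n - 1 - c) else 0)
        + (if r.val + 1 < n then expResidue q θ n (i + 1) (n - (r + 1)) (n - 1 - c) else 0)
        = expResidue q θ n (i + 1) e (n - 1 - c) := by
      by_cases h : r.val + 1 = n
      · rw [if_pos h, if_neg (by omega), show e = 0 by omega, add_zero]
      · rw [if_neg h, if_pos (by omega), show n - (r.val + 1) = e by omega, zero_add]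
    -- In the first column, where right multiplication by `N` gives zero, the formula asks for the
    -- residue with exponent `n`; it vanishes because the pole has been cancelled.
    have hL : (if 0 < c.val then expResidue q θ n (i + 1) (n - r) (n - 1 - (c - 1)) else 0)
        = expResidue q θ n (i + 1) (e + 1) (n - 1 - c + 1) := by
      by_cases h : 0 < c.val
      · rw [if_pos h, he]
        congr 1
        omega
      · rw [if_neg h, show n - 1 - c.val + 1 = n by omega, expResidue_self hq hθ n (i + 1) (by omega)]
    rw [hL, he]
    linear_combination hrec + hR

end ExpCoeff

/-! ### Approximate periods and the vanishing of the truncated exponential -/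

section ApproximatePeriod

variable {k : Type*} [Field k] {p f q : ℕ} [ExpChar k p] {θ lam : k}

/-- The expansion at `t = θ` of `λ θ ∏_{j=1}^l (1 - t / θ^{q^j})⁻¹`. -/
def periodSeries (q : ℕ) (θ lam : k) (l : ℕ) : PowerSeries k :=
  PowerSeries.C (lam * ∏ j ∈ Finset.range (l + 1), θ ^ q ^ j)
    * ∏ j ∈ Finset.range l, (PowerSeries.C (θ ^ q ^ (j + 1) - θ) - PowerSeries.X)⁻¹

/-- The vector of the first `n` coefficients of `y ^ n`, in reverse order. -/
def powCoeffs (n : ℕ) (y : PowerSeries k) (c : Fin n) : k :=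
  PowerSeries.coeff (n - 1 - (c : ℕ)) (y ^ n)

/-- Iterate `λ^q = -θ λ`. Thus `λ ∏_{j<i} θ^{q^j}` is, up to sign, a `q^i`-th power. -/
theorem qpow_eq_mul_prod (hq : q = p ^ f) (hq2 : 2 ≤ q) (hlam : lam ^ (q - 1) = -θ) (i : ℕ) :
    lam ^ q ^ i = lam * ∏ j ∈ Finset.range i, -θ ^ q ^ j := by
  induction i with
  | zero => simp
  | succ i ih =>
    have h1 : lam ^ q = -θ * lam := by
      rw [← hlam, ← pow_succ, Nat.sub_add_cancel (by omega)]
    have h2 : ∀ j, (-θ ^ q ^ j) ^ q = -θ ^ q ^ (j + 1) := fun j => by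
      have := neg_pow_qpow (R := k) hq 1 (by rw [pow_one]; omega) (θ ^ q ^ j)
      rw [pow_one] at this
      rw [this, ← pow_mul, pow_succ]
    rw [pow_succ, pow_mul, ih, mul_pow, h1, ← Finset.prod_pow, Finset.prod_range_succ']
    simp only [h2]
    rw [pow_zero, pow_one]
    ring

theorem mapLaurent_coe_inv_sub_X (φ : k →+* k) {c : k} (hc : c ≠ 0) :
    mapLaurent φ (HahnSeries.ofPowerSeries ℤ k (PowerSeries.C c - PowerSeries.X)⁻¹)
      = -(linFactor (-φ c))⁻¹ := by
  have h : (PowerSeries.C c - PowerSeries.X : PowerSeries k)⁻¹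
      = -(PowerSeries.X + PowerSeries.C (-c))⁻¹ := by
    rw [PowerSeries.inv_eq_iff_mul_eq_one (by simpa using hc),
      show (PowerSeries.C c - PowerSeries.X : PowerSeries k) = -(PowerSeries.X + PowerSeries.C (-c)) by
        rw [map_neg]; ring, neg_mul_neg, PowerSeries.inv_mul_cancel _ (by simpa using hc)]
  rw [h, map_neg, map_neg, ← linFactor_inv_eq_coe (neg_ne_zero.mpr hc), map_inv₀,
    mapLaurent_linFactor, map_neg]

/-- The constant depends only on `i + d`: `λ^{q^i}` supplies the factors `θ^{q^j}` with `j < i` and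
the sign `(-1)^i`, while reversing `d` linear factors supplies `(-1)^d`. This is what lets all terms
with `i + d = l` come from one rational function. -/
theorem mapLaurent_periodSeries (hq : q = p ^ f) (hq2 : 2 ≤ q)
    (hθ : ∀ m, θ ^ q ^ (m + 1) - θ ≠ 0) (hlam : lam ^ (q - 1) = -θ) (i d : ℕ) {φ : k →+* k}
    (hφ : ∀ x, φ x = x ^ q ^ i) :
    mapLaurent φ (HahnSeries.ofPowerSeries ℤ k (periodSeries q θ lam d))
      = HahnSeries.C ((-1) ^ (i + d) * (lam * ∏ j ∈ Finset.range (i + d + 1), θ ^ q ^ j))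
        * ∏ j ∈ Finset.range d, (linFactor (θ ^ q ^ i - θ ^ q ^ (i + j + 1)))⁻¹ := by
  have h1 : ∀ j, φ (θ ^ q ^ (j + 1) - θ) = θ ^ q ^ (i + j + 1) - θ ^ q ^ i := fun j => by
    rw [hφ, add_assoc, qpow_sub_qpow hq]
  have h2 : φ (lam * ∏ j ∈ Finset.range (d + 1), θ ^ q ^ j)
      = (-1) ^ i * (lam * ∏ j ∈ Finset.range (i + d + 1), θ ^ q ^ j) := by
    rw [map_mul, hφ, qpow_eq_mul_prod hq hq2 hlam, map_prod, add_assoc,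
      Finset.prod_range_add (fun j => θ ^ q ^ j) i (d + 1),
      Finset.prod_neg, Finset.card_range]
    have : ∀ j, φ (θ ^ q ^ j) = θ ^ q ^ (i + j) := fun j => by
      rw [hφ, ← pow_mul, ← pow_add, add_comm]
    simp only [this]
    ring
  have h3 : ∀ j, mapLaurent φ (HahnSeries.ofPowerSeries ℤ k
      (PowerSeries.C (θ ^ q ^ (j + 1) - θ) - PowerSeries.X)⁻¹)
        = -(linFactor (θ ^ q ^ i - θ ^ q ^ (i + j + 1)))⁻¹ := fun j => by
    rw [mapLaurent_coe_inv_sub_X φ (hθ j), h1, neg_sub]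
  have h4 : ∀ c : k, mapLaurent φ (HahnSeries.C c) = HahnSeries.C (φ c) := fun c =>
    HahnSeries.map_C c φ
  rw [periodSeries, map_mul, map_mul, HahnSeries.ofPowerSeries_C, h4, h2, map_prod, map_prod]
  simp only [h3]
  rw [Finset.prod_neg, Finset.card_range, pow_add, mul_right_comm, map_mul _ (_ * _) ((-1) ^ d),
    map_pow _ _ d, map_neg, map_one]
  ring

/-- The matrix product pairs Taylor coefficients with residues, which is the residue of the product;
coefficients from degree `n` on do not contribute, as the pole has order at most `n`. -/
theorem expCoeff_mulVec_powCoeffs (hq : q = p ^ f) (hθ : ∀ m, θ ^ q ^ (m + 1) - θ ≠ 0)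
    (n i : ℕ) (y : PowerSeries k) {φ : k →+* k} (hφ : ∀ x, φ x = x ^ q ^ i) (r : Fin n) :
    (expCoeff q θ n i).mulVec (fun c => powCoeffs n y c ^ q ^ i) r
      = (mapLaurent φ (HahnSeries.ofPowerSeries ℤ k y) ^ n * poleFactor q θ n i i (n - r)).coeff
          (-1) := by
  rw [← map_pow, ← map_pow, mapLaurent_coe,
    coeff_coe_mul_eq_sum _ _ n (single_mul_poleFactor_mem hq hθ n i (Nat.sub_le n r)),
    ← Finset.sum_range_reflect, ← Fin.sum_univ_eq_sum_range, expCoeff_eq hq hθ, Matrix.mulVec,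
    dotProduct]
  refine Finset.sum_congr rfl fun c _ => ?_
  rw [Matrix.of_apply, powCoeffs, PowerSeries.coeff_map, hφ, mul_comm]
  rfl

theorem sum_expCoeff_mulVec_powCoeffs (hq : q = p ^ f) (hq2 : 2 ≤ q)
    (hθ : ∀ m, θ ^ q ^ (m + 1) - θ ≠ 0) (hlam : lam ^ (q - 1) = -θ) (n : ℕ) {l : ℕ} (hl : 1 ≤ l) :
    ∑ i ∈ Finset.range (l + 1), (expCoeff q θ n i).mulVec
      (fun c => powCoeffs n (periodSeries q θ lam (l - i)) c ^ q ^ i) = 0 := by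
  ext r
  set κ := (-1) ^ l * (lam * ∏ j ∈ Finset.range (l + 1), θ ^ q ^ j)
  -- Pole orders of the common rational function at the nodes `θ^{q^j}`.
  let m : ℕ → ℕ := fun j => if j = 0 then n - r else n
  have key : ∀ i ∈ Finset.range (l + 1), (expCoeff q θ n i).mulVec
      (fun c => powCoeffs n (periodSeries q θ lam (l - i)) c ^ q ^ i) r
        = κ ^ n * (∏ j ∈ Finset.range (l + 1),
          (linFactor (θ ^ q ^ i - θ ^ q ^ j))⁻¹ ^ m j : k⸨X⸩).coeff (-1) := by
    intro i hi
    obtain ⟨d, rfl⟩ := Nat.exists_eq_add_of_le (Nat.lt_succ_iff.mp (Finset.mem_range.mp hi))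
    obtain ⟨φ, hφ⟩ := exists_qpow_hom (k := k) hq i
    rw [Nat.add_sub_cancel_left, expCoeff_mulVec_powCoeffs hq hθ n i _ hφ,
      mapLaurent_periodSeries hq hq2 hθ hlam i d hφ, ← smul_eq_mul (κ ^ n), ← HahnSeries.coeff_smul,
      ← HahnSeries.C_mul_eq_smul, mul_pow, map_pow, mul_assoc]
    congr 2
    rw [Finset.prod_range_succ', Finset.prod_range_add, poleFactor, ← Finset.prod_pow]
    simp only [m, if_true, Nat.add_eq_zero_iff, one_ne_zero, and_false, if_false, pow_zero, pow_one]
    ring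
  rw [Finset.sum_apply, Finset.sum_congr rfl key, ← Finset.mul_sum]
  refine mul_eq_zero_of_right _ (residueSum_eq_zero (a := fun j => θ ^ q ^ j) ?_ m ?_)
  · intro i j h
    by_contra hij
    exact qpow_sub_ne_zero hq hθ hij (sub_eq_zero.mpr h)
  · have h0 : m 0 = n - r := rfl
    have h1 : m 1 = n := rfl
    have h2 := Finset.sum_le_sum_of_subset (f := m)
      (Finset.range_mono (by omega : 2 ≤ l + 1))
    rw [Finset.sum_range_succ, Finset.sum_range_one, h0, h1] at h2
    omega

end ApproximatePeriod

/-! ### Convergence of the exponential series -/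

section Convergence

open Filter Topology

variable {L : Type*} [NormedField L] {q n : ℕ} {θ : L}

theorem norm_shiftN_apply_le (r c : Fin n) : ‖shiftN L n r c‖ ≤ 1 := by
  rw [shiftN, Matrix.of_apply]
  split_ifs <;> simp

theorem norm_cornerE_apply_le (r c : Fin n) : ‖cornerE L n r c‖ ≤ 1 := by
  rw [cornerE, Matrix.of_apply]
  split_ifs <;> simp

variable [IsUltrametricDist L]

theorem norm_mul_apply_le {A B : Matrix (Fin n) (Fin n) L} {a b : ℝ} (ha : 0 ≤ a) (hb : 0 ≤ b)
    (hA : ∀ r c, ‖A r c‖ ≤ a) (hB : ∀ r c, ‖B r c‖ ≤ b) (r c : Fin n) :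
    ‖(A * B) r c‖ ≤ a * b := by
  rw [Matrix.mul_apply]
  refine IsUltrametricDist.norm_sum_le_of_forall_le_of_nonneg (mul_nonneg ha hb) fun i _ => ?_
  rw [norm_mul]
  exact mul_le_mul (hA _ _) (hB _ _) (norm_nonneg _) ha

theorem norm_adN_iterate_apply_le {A : Matrix (Fin n) (Fin n) L} {a : ℝ} (ha : 0 ≤ a)
    (hA : ∀ r c, ‖A r c‖ ≤ a) (m : ℕ) (r c : Fin n) : ‖(adN n)^[m] A r c‖ ≤ a := by
  induction m generalizing r c with
  | zero => exact hA r c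
  | succ m ih =>
    rw [Function.iterate_succ_apply', adN, Matrix.sub_apply]
    rw [sub_eq_add_neg]
    refine (IsUltrametricDist.norm_add_le_max _ _).trans (max_le ?_ ((norm_neg _).trans_le ?_))
    · simpa using norm_mul_apply_le ha zero_le_one ih norm_shiftN_apply_le r c
    · simpa using norm_mul_apply_le zero_le_one ha norm_shiftN_apply_le ih r c

theorem norm_qpow_sub (hq2 : 2 ≤ q) (hθ : 1 < ‖θ‖) (i : ℕ) :
    ‖θ ^ q ^ (i + 1) - θ‖ = ‖θ‖ ^ q ^ (i + 1) := by
  have h1 : 1 < q ^ (i + 1) := Nat.one_lt_pow (by omega) (by omega)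
  have h2 : ‖θ‖ < ‖θ ^ q ^ (i + 1)‖ := by
    rw [norm_pow]
    exact lt_self_pow₀ hθ h1
  rw [sub_eq_add_neg, IsUltrametricDist.norm_add_eq_max_of_norm_ne_norm (by rw [norm_neg]; exact h2.ne'),
    norm_neg, max_eq_left h2.le, norm_pow]

/-- Each recursion step raises entries to the power `q` and divides at least once by an element of
norm `|θ|^{q^{i+1}}`; the matrices `N` and `E` do not increase norms. -/
theorem norm_expCoeff_apply_le (hq2 : 2 ≤ q) (hθ : 1 < ‖θ‖) (i : ℕ) (r c : Fin n) :
    ‖expCoeff q θ n i r c‖ ≤ (‖θ‖ ^ (i * q ^ i))⁻¹ := by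
  induction i generalizing r c with
  | zero =>
    rw [expCoeff, Matrix.one_apply]
    split_ifs <;> simp
  | succ i ih =>
    have h0 : 0 < ‖θ‖ := zero_lt_one.trans hθ
    rw [expCoeff, Matrix.sum_apply]
    refine IsUltrametricDist.norm_sum_le_of_forall_le_of_nonneg (by positivity) fun m _ => ?_
    have h1 : ∀ r c, ‖(expCoeff q θ n i).map (· ^ q) r c‖ ≤ (‖θ‖ ^ (i * q ^ (i + 1)))⁻¹ := by
      intro r c
      rw [Matrix.map_apply, norm_pow, pow_succ, ← mul_assoc, pow_mul, ← inv_pow]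
      exact pow_le_pow_left₀ (norm_nonneg _) (ih r c) q
    have h2 := norm_adN_iterate_apply_le (by positivity)
      (norm_mul_apply_le zero_le_one (by positivity) norm_cornerE_apply_le h1) m r c
    rw [one_mul] at h2
    rw [Matrix.smul_apply, smul_eq_mul, norm_mul, norm_mul, norm_pow, norm_neg, norm_one, one_pow,
      one_mul, norm_inv, norm_pow, norm_qpow_sub hq2 hθ, show (i + 1) * q ^ (i + 1)
        = q ^ (i + 1) + i * q ^ (i + 1) by ring, pow_add ‖θ‖, mul_inv]
    refine mul_le_mul ?_ h2 (norm_nonneg _) (by positivity)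
    refine inv_anti₀ (by positivity) ?_
    exact le_self_pow₀ (one_le_pow₀ hθ.le) (by omega)

theorem norm_expCoeff_mulVec_le (hq2 : 2 ≤ q) (hθ : 1 < ‖θ‖) (i : ℕ) {R : ℝ} (hR : 0 ≤ R)
    {z : Fin n → L} (hz : ‖z‖ ≤ R) :
    ‖(expCoeff q θ n i).mulVec (fun c => z c ^ q ^ i)‖ ≤ (R / ‖θ‖ ^ i) ^ q ^ i := by
  rw [pi_norm_le_iff_of_nonneg (by positivity)]
  intro r
  rw [Matrix.mulVec, dotProduct]
  refine IsUltrametricDist.norm_sum_le_of_forall_le_of_nonneg (by positivity) fun c _ => ?_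
  rw [norm_mul, norm_pow, div_pow, ← pow_mul, div_eq_inv_mul]
  exact mul_le_mul (norm_expCoeff_apply_le hq2 hθ i r c)
    (pow_le_pow_left₀ (norm_nonneg _) ((norm_le_pi_norm z c).trans hz) _) (by positivity)
    (by positivity)

theorem summable_div_pow_pow (hq2 : 2 ≤ q) {B : ℝ} (hB : 1 < B) {R : ℝ} (hR : 0 ≤ R) :
    Summable fun i : ℕ => (R / B ^ i) ^ q ^ i := by
  have h0 : 0 < B := zero_lt_one.trans hB
  have h1 : Tendsto (fun i : ℕ => R / B ^ i) atTop (𝓝 0) :=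
    (tendsto_pow_atTop_atTop_of_one_lt hB).const_div_atTop R
  have h2 : ∀ᶠ i : ℕ in atTop, R / B ^ i ≤ 1 / 2 := h1.eventually_le_const (by norm_num)
  refine Summable.of_norm_bounded_eventually_nat (g := fun i => (1 / 2 : ℝ) ^ i)
    (summable_geometric_of_lt_one (by norm_num) (by norm_num)) ?_
  filter_upwards [h2] with i hi
  rw [Real.norm_of_nonneg (by positivity)]
  refine (pow_le_pow_left₀ (by positivity) hi _).trans ?_
  exact pow_le_pow_of_le_one (by norm_num) (by norm_num) (Nat.lt_pow_self (by omega)).le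

/-- If the truncated exponential sums of approximations to `z` vanish, so does `exp z`. -/
theorem tensorExp_eq_zero_of_tendsto [CompleteSpace L] (hq2 : 2 ≤ q) (hθ : 1 < ‖θ‖)
    {y : ℕ → Fin n → L} {z : Fin n → L} (hyz : Tendsto y atTop (𝓝 z))
    (hy : ∀ l, 1 ≤ l → ∑ i ∈ Finset.range (l + 1), (expCoeff q θ n i).mulVec
      (fun c => y (l - i) c ^ q ^ i) = 0) : tensorExp q θ n z = 0 := by
  obtain ⟨R, hR⟩ := hyz.norm.bddAbove_range
  have hR' : ∀ d, ‖y d‖ ≤ R := fun d => hR ⟨d, rfl⟩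
  have hR0 : 0 ≤ R := (norm_nonneg _).trans (hR' 0)
  -- The `l`-th truncated sum is viewed as a full series with zero terms for `i > l`; a common bound
  -- on the norms of all `y d` gives the dominating series.
  have key := tendsto_tsum_of_dominated_convergence (𝓕 := atTop)
    (f := fun l i => if i ≤ l then (expCoeff q θ n i).mulVec (fun c => y (l - i) c ^ q ^ i) else 0)
    (g := fun i => (expCoeff q θ n i).mulVec (fun c => z c ^ q ^ i))
    (summable_div_pow_pow hq2 hθ hR0) (fun i => ?_) (Eventually.of_forall fun l i => ?_)
  · refine tendsto_nhds_unique key (tendsto_const_nhds.congr' ?_)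
    filter_upwards [eventually_ge_atTop 1] with l hl
    rw [tsum_eq_sum (s := Finset.range (l + 1)) fun i hi => if_neg (by simpa using hi), ← hy l hl]
    exact Finset.sum_congr rfl fun i hi =>
      (if_pos (Nat.lt_succ_iff.mp (Finset.mem_range.mp hi))).symm
  · have h1 : Tendsto (fun l => (expCoeff q θ n i).mulVec (fun c => y (l - i) c ^ q ^ i)) atTop
        (𝓝 ((expCoeff q θ n i).mulVec (fun c => z c ^ q ^ i))) := by
      have h2 : Continuous fun x : Fin n → L =>
          (expCoeff q θ n i).mulVec (fun c => x c ^ q ^ i) :=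
        Continuous.matrix_mulVec continuous_const
          (continuous_pi fun c => (continuous_apply c).pow _)
      exact (h2.tendsto z).comp (hyz.comp (tendsto_sub_atTop_nat i))
    refine h1.congr' ?_
    filter_upwards [eventually_ge_atTop i] with l hl
    rw [if_pos hl]
  · split_ifs
    · exact norm_expCoeff_mulVec_le hq2 hθ i hR0 (hR' _)
    · rw [norm_zero]
      have := zero_lt_one.trans hθ
      positivity

end Convergence

/-! ### Infinite products of power series in the field of Laurent series -/

section InfiniteProduct

open Filter Topology

variable {F : Type*} [Field F]

theorem X_pow_dvd_prod_sub_one {l : ℕ} {u : ℕ → PowerSeries F} {s : Finset ℕ}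
    (hu : ∀ j ∈ s, PowerSeries.X ^ l ∣ u j - 1) : PowerSeries.X ^ l ∣ ∏ j ∈ s, u j - 1 := by
  refine Finset.prod_induction u (fun a => PowerSeries.X ^ l ∣ a - 1) (fun a b ha hb => ?_)
    (by simp) hu
  rw [show a * b - 1 = (a - 1) * b + (b - 1) by ring]
  exact dvd_add (ha.mul_right b) hb

theorem X_pow_dvd_prod_sub_prod_range {l : ℕ} {u : ℕ → PowerSeries F}
    (hu : ∀ j, PowerSeries.X ^ (j + 1) ∣ u j - 1) {s : Finset ℕ} (hs : Finset.range l ⊆ s) :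
    PowerSeries.X ^ (l + 1) ∣ ∏ j ∈ s, u j - ∏ j ∈ Finset.range l, u j := by
  rw [← Finset.prod_sdiff hs, ← sub_one_mul]
  refine Dvd.dvd.mul_right (X_pow_dvd_prod_sub_one fun j hj => ?_) _
  have : l ≤ j := by simpa using (Finset.mem_sdiff.mp hj).2
  exact (pow_dvd_pow _ (by omega)).trans (hu j)

theorem tendsto_coe_of_X_pow_dvd {ι : Type*} {g : Filter ι} {v : ι → PowerSeries F}
    {P : PowerSeries F} (h : ∀ l, ∀ᶠ i in g, PowerSeries.X ^ l ∣ v i - P) :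
    Tendsto (fun i => (v i : F⸨X⸩)) g (𝓝 (P : F⸨X⸩)) := by
  intro U hU
  obtain ⟨γ, hγ⟩ := Valued.mem_nhds.mp hU
  set γ' := MonoidWithZeroHom.ValueGroup₀.embedding γ.1
  -- Chosen so that valuation at most `exp(-d)` lies strictly inside the neighbourhood.
  set d := -(WithZero.log γ' - 1) with hd
  have hd' : WithZero.exp (-d) < γ' := by
    rw [← WithZero.lt_log_iff_exp_lt (by simp [γ']), hd]
    simp
  rw [Filter.mem_map]
  filter_upwards [h d.toNat] with i hi
  refine hγ ?_
  change (Valued.v : Valuation F⸨X⸩ (WithZero (Multiplicative ℤ))).restrict _ < _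
  rw [Valuation.restrict_lt_iff_lt_embedding]
  refine lt_of_le_of_lt ((LaurentSeries.valuation_le_iff_coeff_lt_eq_zero F).mpr ?_) hd'
  intro m hm
  rw [← map_sub, PowerSeries.coeff_coe]
  split_ifs with h0
  · rfl
  · exact PowerSeries.X_pow_dvd_iff.mp hi _ (by omega)

theorem exists_hasProd_coe {u : ℕ → PowerSeries F}
    (hu : ∀ j, PowerSeries.X ^ (j + 1) ∣ u j - 1) :
    ∃ P : PowerSeries F, HasProd (fun j => (u j : F⸨X⸩)) (P : F⸨X⸩) ∧
      ∀ l, PowerSeries.X ^ (l + 1) ∣ P - ∏ j ∈ Finset.range l, u j := by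
  -- Factors with index `j ≥ k` do not affect the coefficient of degree `k`, which is therefore
  -- final after `k` factors.
  let P : PowerSeries F := PowerSeries.mk fun k =>
    PowerSeries.coeff k (∏ j ∈ Finset.range k, u j)
  have hP : ∀ l, PowerSeries.X ^ (l + 1) ∣ P - ∏ j ∈ Finset.range l, u j := by
    intro l
    rw [PowerSeries.X_pow_dvd_iff]
    intro m hm
    have := PowerSeries.X_pow_dvd_iff.mp (X_pow_dvd_prod_sub_prod_range hu
      (Finset.range_mono (Nat.lt_succ_iff.mp hm))) m m.lt_succ_self
    rw [map_sub, sub_eq_zero] at this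
    rw [map_sub, PowerSeries.coeff_mk, this, sub_self]
  refine ⟨P, ?_, hP⟩
  have key : Tendsto (fun s : Finset ℕ => ((∏ j ∈ s, u j : PowerSeries F) : F⸨X⸩)) atTop
      (𝓝 (P : F⸨X⸩)) := by
    refine tendsto_coe_of_X_pow_dvd fun l => ?_
    filter_upwards [eventually_ge_atTop (Finset.range l)] with s hs
    have h1 := dvd_sub (X_pow_dvd_prod_sub_prod_range hu hs) (hP l)
    rw [sub_sub_sub_cancel_right] at h1
    exact (pow_dvd_pow _ l.le_succ).trans h1
  rw [HasProd, SummationFilter.unconditional_filter]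
  simpa only [map_prod] using key

theorem coe_X_pow (m : ℕ) : ((PowerSeries.X ^ m : PowerSeries F) : F⸨X⸩)
    = HahnSeries.single (m : ℤ) 1 := by
  rw [map_pow, HahnSeries.ofPowerSeries_X, HahnSeries.single_pow]
  simp

theorem one_sub_X_pow_mul_inv {m : ℕ} (hm : m ≠ 0) :
    (1 - PowerSeries.X ^ m : PowerSeries F) * (1 - PowerSeries.X ^ m)⁻¹ = 1 :=
  PowerSeries.mul_inv_cancel _ (by simp [hm])

/-- The factors of the product `∏_{j ≥ 1} (1 - θ^{1 - q^j})⁻¹`. -/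
def periodFactor (F : Type*) [Field F] (q j : ℕ) : F⸨X⸩ :=
  (1 - thetaInf F ^ (1 - (q : ℤ) ^ (j + 1)))⁻¹

theorem periodFactor_mul {q : ℕ} (hq2 : 2 ≤ q) (j : ℕ) :
    periodFactor F q j * (thetaInf F ^ q ^ (j + 1) - thetaInf F) = thetaInf F ^ q ^ (j + 1) := by
  have h0 : thetaInf F ≠ 0 := HahnSeries.single_ne_zero one_ne_zero
  have h1 : thetaInf F ^ q ^ (j + 1) * thetaInf F ^ (1 - (q : ℤ) ^ (j + 1)) = thetaInf F := by
    rw [← zpow_natCast, ← zpow_add₀ h0]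
    push_cast
    rw [add_sub_cancel, zpow_one]
  have h2 := thetaInf_qpow_sub_ne_zero (F := F) hq2 j
  have h3 : thetaInf F ^ q ^ (j + 1) - thetaInf F
      = thetaInf F ^ q ^ (j + 1) * (1 - thetaInf F ^ (1 - (q : ℤ) ^ (j + 1))) := by
    rw [mul_sub, h1, mul_one]
  rw [h3] at h2
  rw [h3, periodFactor, mul_comm, mul_assoc, mul_inv_cancel₀ (right_ne_zero_of_mul h2), mul_one]

theorem periodProduct_ne_zero_and_coeff_sub_eq_zero {q : ℕ} (hq2 : 2 ≤ q) :
    (∏' j : ℕ, (1 - thetaInf F ^ (1 - (q : ℤ) ^ (j + 1)))⁻¹) ≠ 0 ∧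
      ∀ l : ℕ, ∀ i ≤ (l : ℤ), ((∏' j : ℕ, (1 - thetaInf F ^ (1 - (q : ℤ) ^ (j + 1)))⁻¹)
        - ∏ j ∈ Finset.range l, periodFactor F q j).coeff i = 0 := by
  have hm : ∀ j, j + 1 ≤ q ^ (j + 1) - 1 := fun j => by
    have := Nat.lt_pow_self (n := j + 1) (a := q) (by omega)
    omega
  -- The factors of the period, rewritten in the variable `1/θ`.
  let u : ℕ → PowerSeries F := fun j => (1 - PowerSeries.X ^ (q ^ (j + 1) - 1))⁻¹
  have hu1 : ∀ j, (1 - PowerSeries.X ^ (q ^ (j + 1) - 1)) * u j = 1 := fun j =>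
    one_sub_X_pow_mul_inv (by have := hm j; omega)
  have hu : ∀ j, PowerSeries.X ^ (j + 1) ∣ u j - 1 := fun j => by
    refine (pow_dvd_pow _ (hm j)).trans ⟨u j, ?_⟩
    linear_combination hu1 j
  have hcoe : ∀ j, (u j : F⸨X⸩) = (1 - thetaInf F ^ (1 - (q : ℤ) ^ (j + 1)))⁻¹ := fun j => by
    have h1 : thetaInf F ^ (1 - (q : ℤ) ^ (j + 1))
        = ((PowerSeries.X ^ (q ^ (j + 1) - 1) : PowerSeries F) : F⸨X⸩) := by
      have h2 := Nat.one_le_pow (j + 1) q (by omega)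
      rw [coe_X_pow, show (1 - (q : ℤ) ^ (j + 1)) = -((q ^ (j + 1) - 1 : ℕ) : ℤ) by
        push_cast [Nat.cast_sub h2]; ring, zpow_neg, zpow_natCast, thetaInf_pow,
        HahnSeries.inv_single, neg_neg, inv_one]
    rw [h1, ← map_one (HahnSeries.ofPowerSeries ℤ F), ← map_sub]
    refine (inv_eq_of_mul_eq_one_right ?_).symm
    rw [← map_mul, hu1, map_one]
  obtain ⟨P, hP, hPl⟩ := exists_hasProd_coe hu
  simp only [hcoe] at hP
  rw [hP.tprod_eq]
  have hprod : ∀ l, ∏ j ∈ Finset.range l, periodFactor F q j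
      = ((∏ j ∈ Finset.range l, u j : PowerSeries F) : F⸨X⸩) := fun l => by
    rw [map_prod]
    exact Finset.prod_congr rfl fun j _ => (hcoe j).symm
  refine ⟨?_, fun l i hi => ?_⟩
  · rw [map_ne_zero_iff _ HahnSeries.ofPowerSeries_injective]
    intro h
    have := PowerSeries.X_pow_dvd_iff.mp (hPl 0) 0 one_pos
    simp [h] at this
  · rw [hprod, ← map_sub, PowerSeries.coeff_coe]
    split_ifs with h0
    · rfl
    · exact PowerSeries.X_pow_dvd_iff.mp (hPl l) _ (by omega)

end InfiniteProduct

/-! ### The translate of `π̃ / η` -/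

section PeriodExpansion

variable {F : Type*} [Field F] {L : Type*} [Field L] [Algebra F⸨X⸩ L] {p f q : ℕ}
  [ExpChar (KSep F L) p]

theorem inv_pow_eq_pow_inv {k : Type*} [Field k] {y : PowerSeries k}
    (hy : PowerSeries.constantCoeff y ≠ 0) (n : ℕ) : (y ^ n)⁻¹ = y⁻¹ ^ n := by
  rw [PowerSeries.inv_eq_iff_mul_eq_one (by rw [map_pow]; exact pow_ne_zero _ hy), ← mul_pow,
    PowerSeries.inv_mul_cancel _ hy, one_pow]

theorem map_inv_of_constantCoeff_ne_zero {k k' : Type*} [Field k] [Field k']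
    (g : PowerSeries k →+* PowerSeries k') {y : PowerSeries k}
    (hy : PowerSeries.constantCoeff y ≠ 0) (hgy : PowerSeries.constantCoeff (g y) ≠ 0) :
    g y⁻¹ = (g y)⁻¹ := by
  rw [PowerSeries.eq_inv_iff_mul_eq_one hgy, ← map_mul, PowerSeries.inv_mul_cancel _ hy, map_one]

variable (F L q) in
/-- The translate of `η`. -/
def etaTranslate : PowerSeries (KSep F L) := translate (taylorSep F L) (eta q (thetaSep F L))

theorem constantCoeff_etaTranslate (hq2 : 2 ≤ q) :
    PowerSeries.constantCoeff (etaTranslate F L q) = 1 := by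
  rw [etaTranslate, ← PowerSeries.coeff_zero_eq_constantCoeff_apply, coeff_translate,
    translateCoeff]
  simp [constantCoeff_eta hq2]

variable (F L q) in
/-- The power series `∑_j ∂_θ^{(j)}(π̃ / η)|_{t = θ} X^j`. -/
def periodExpansion (lam : KSep F L) : PowerSeries (KSep F L) :=
  taylorSep F L (carlitzPeriod F q L lam) * (etaTranslate F L q)⁻¹

theorem constantCoeff_periodExpansion (hq2 : 2 ≤ q) (lam : KSep F L) :
    PowerSeries.constantCoeff (periodExpansion F L q lam) = carlitzPeriod F q L lam := by
  rw [periodExpansion, map_mul, (taylorSep_spec F L).1, PowerSeries.constantCoeff_inv,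
    constantCoeff_etaTranslate hq2, inv_one, mul_one]

/-- Translation is multiplicative and respects congruences modulo powers of `t - θ`, so `α_n/Γ_n`
may be replaced by `η^{-n}`. -/
theorem eval_hyperderivPoly_mul_period (hq : q = p ^ f) (hq2 : 2 ≤ q) (lam : KSep F L) {n j : ℕ}
    (hn : 1 ≤ n) (hj : j ≤ n) :
    (hyperderivPoly F L j (andersonThakurQuot q (thetaSep F L) n *
      Polynomial.C (carlitzPeriod F q L lam ^ n))).eval (thetaSep F L)
      = PowerSeries.coeff j (periodExpansion F L q lam ^ n) := by
  have h1 : expandAt (thetaSep F L) (Polynomial.C (carlitzPeriod F q L lam ^ n))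
      = PowerSeries.C (carlitzPeriod F q L lam ^ n) := by
    rw [expandAt, Polynomial.coe_eval₂RingHom, Polynomial.eval₂_C]
  have hη0 : PowerSeries.constantCoeff (eta q (thetaSep F L)) ≠ 0 := by
    rw [constantCoeff_eta hq2]
    exact one_ne_zero
  have hH0 : PowerSeries.constantCoeff (etaTranslate F L q) ≠ 0 := by
    rw [constantCoeff_etaTranslate hq2]
    exact one_ne_zero
  have h2 : translate (taylorSep F L) (eta q (thetaSep F L) ^ n)⁻¹ = (etaTranslate F L q)⁻¹ ^ n := by
    rw [inv_pow_eq_pow_inv hη0, map_pow, map_inv_of_constantCoeff_ne_zero _ hη0 hH0, etaTranslate]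
  rw [eval_hyperderivPoly_theta, map_mul, map_mul, h1, translate_C, map_pow, periodExpansion,
    mul_pow, mul_comm, PowerSeries.coeff_mul, PowerSeries.coeff_mul]
  refine Finset.sum_congr rfl fun x hx => ?_
  have hx2 := Finset.HasAntidiagonal.antidiagonal.snd_le hx
  rw [← h2]
  congr 1
  exact coeff_translate_congr _ fun i hi => coeff_expandAt_andersonThakurQuot hq hq2
    (thetaSep_qpow_sub_ne_zero hq2) hn (by omega)

theorem X_pow_dvd_translate {k : Type*} [Field k] (D : k →+* PowerSeries k) {l : ℕ}
    {a : PowerSeries k} (h : PowerSeries.X ^ l ∣ a) : PowerSeries.X ^ l ∣ translate D a := by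
  obtain ⟨b, rfl⟩ := h
  rw [map_mul, map_pow, translate_X, neg_pow]
  exact ((Dvd.intro_left _ rfl).mul_right _)

/-- In each numerator `θ^{q^m} - θ + (t - θ)^{q^m}`, the substitution `θ ↦ θ + X` followed by `t =
θ` adds `X^{q^m} - X` from the first two terms and turns the last into `-X^{q^m}`; what is left is
`θ^{q^m} - θ - X`. -/
theorem translate_etaPartial_mul (hq : q = p ^ f) (hq2 : 2 ≤ q) (l : ℕ) :
    translate (taylorSep F L) (etaPartial q (thetaSep F L) l)
        * taylorSep F L (∏ j ∈ Finset.range l, (thetaSep F L ^ q ^ (j + 1) - thetaSep F L))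
      = ∏ j ∈ Finset.range l,
          (PowerSeries.C (thetaSep F L ^ q ^ (j + 1) - thetaSep F L) - PowerSeries.X) := by
  rw [← translate_C, ← map_mul, map_prod, etaPartial_eq_prod_range, ← Finset.prod_mul_distrib,
    map_prod]
  refine Finset.prod_congr rfl fun j _ => ?_
  have h1 := thetaSep_qpow_sub_ne_zero (F := F) (L := L) hq2 j
  have h2 : PowerSeries.C (thetaSep F L ^ q ^ (j + 1) - thetaSep F L)⁻¹
      * PowerSeries.C (thetaSep F L ^ q ^ (j + 1) - thetaSep F L) = 1 := by
    rw [← map_mul, inv_mul_cancel₀ h1, map_one]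
  rw [add_mul, one_mul, mul_right_comm, h2, one_mul, map_add, map_pow, translate_X, translate_C,
    neg_pow_qpow hq _ (by positivity), map_sub, map_pow, taylorSep_theta, add_pow_qpow hq, map_sub,
    map_pow]
  ring

/-- The element is `±λ^{q^l}`, and the Taylor series of a `q^l`-th power is constant below degree
`q^l > l`. -/
theorem X_pow_dvd_taylorSep_sub_C (hq : q = p ^ f) (hq2 : 2 ≤ q) {lam : KSep F L}
    (hlam : lam ^ (q - 1) = -thetaSep F L) (l : ℕ) :
    PowerSeries.X ^ l ∣ taylorSep F L (lam * ∏ j ∈ Finset.range l, thetaSep F L ^ q ^ j)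
      - PowerSeries.C (lam * ∏ j ∈ Finset.range l, thetaSep F L ^ q ^ j) := by
  have h1 : lam * ∏ j ∈ Finset.range l, thetaSep F L ^ q ^ j = (-1) ^ l * lam ^ q ^ l := by
    rw [qpow_eq_mul_prod hq hq2 hlam, Finset.prod_neg, Finset.card_range, mul_left_comm,
      ← mul_assoc ((-1) ^ l), ← mul_pow, neg_one_mul, neg_neg, one_pow, one_mul]
  have h2 : PowerSeries.X ∣ taylorSep F L lam - PowerSeries.C lam := by
    rw [PowerSeries.X_dvd_iff, map_sub, (taylorSep_spec F L).1, PowerSeries.constantCoeff_C, sub_self]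
  have h3 : taylorSep F L ((-1) ^ l) = (-1) ^ l := by simp
  have h4 : (PowerSeries.C ((-1) ^ l) : PowerSeries (KSep F L)) = (-1) ^ l := by simp
  rw [h1, map_mul, map_mul, h3, h4, ← mul_sub, map_pow, map_pow, ← sub_pow_qpow hq]
  refine Dvd.dvd.mul_left ?_ _
  exact (pow_dvd_pow _ (Nat.lt_pow_self (by omega)).le).trans (pow_dvd_pow_of_dvd h2 _)

variable (F L q) in
/-- The partial products of the Carlitz period. -/
def periodPartial (lam : KSep F L) (l : ℕ) : KSep F L :=
  lam * thetaSep F L * algebraMap F⸨X⸩ (KSep F L) (∏ j ∈ Finset.range l, periodFactor F q j)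

theorem constantCoeff_prod_C_sub_X_ne_zero (hq2 : 2 ≤ q) (l : ℕ) :
    PowerSeries.constantCoeff (∏ j ∈ Finset.range l,
      (PowerSeries.C (thetaSep F L ^ q ^ (j + 1) - thetaSep F L) - PowerSeries.X)) ≠ 0 := by
  rw [map_prod]
  refine Finset.prod_ne_zero_iff.mpr fun j _ => ?_
  simpa using thetaSep_qpow_sub_ne_zero hq2 j

theorem periodSeries_mul {k : Type*} [Field k] (θ lam : k)
    (hθ : ∀ m, θ ^ q ^ (m + 1) - θ ≠ 0) (l : ℕ) :
    periodSeries q θ lam l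
        * ∏ j ∈ Finset.range l, (PowerSeries.C (θ ^ q ^ (j + 1) - θ) - PowerSeries.X)
      = PowerSeries.C (lam * ∏ j ∈ Finset.range (l + 1), θ ^ q ^ j) := by
  have h : ∀ j ∈ Finset.range l, (PowerSeries.C (θ ^ q ^ (j + 1) - θ) - PowerSeries.X)⁻¹
      * (PowerSeries.C (θ ^ q ^ (j + 1) - θ) - PowerSeries.X) = 1 := fun j _ => by
    refine PowerSeries.inv_mul_cancel _ ?_
    simpa using hθ j
  rw [periodSeries, mul_assoc, ← Finset.prod_mul_distrib, Finset.prod_congr rfl h,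
    Finset.prod_const_one, mul_one]

/-- After clearing the denominator `∏ (θ^{q^j} - θ)`, the partial period becomes `λ ∏_{j≤l}
θ^{q^j}`, whose Taylor series is constant to this order, and the translate of `η_l` becomes `∏
(θ^{q^j} - θ - X)`. Their quotient is the truncated period series. -/
theorem X_pow_dvd_sub_periodSeries (hq : q = p ^ f) (hq2 : 2 ≤ q) {lam : KSep F L}
    (hlam : lam ^ (q - 1) = -thetaSep F L) (l : ℕ) :
    PowerSeries.X ^ (l + 1) ∣ taylorSep F L (periodPartial F L q lam l) * (etaTranslate F L q)⁻¹
      - periodSeries q (thetaSep F L) lam l := by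
  have h1 := translate_etaPartial_mul (F := F) (L := L) hq hq2 l
  have h2 := X_pow_dvd_taylorSep_sub_C hq hq2 hlam (l + 1)
  have h3 := periodSeries_mul (thetaSep F L) lam (thetaSep_qpow_sub_ne_zero hq2) l
  have h4 : PowerSeries.X ^ (l + 1) ∣ etaTranslate F L q
      - translate (taylorSep F L) (etaPartial q (thetaSep F L) l) := by
    rw [etaTranslate, ← map_sub]
    exact X_pow_dvd_translate _ (X_pow_dvd_eta_sub_etaPartial hq2 _ l)
  have h5 : periodPartial F L q lam l
      * ∏ j ∈ Finset.range l, (thetaSep F L ^ q ^ (j + 1) - thetaSep F L)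
      = lam * ∏ j ∈ Finset.range (l + 1), thetaSep F L ^ q ^ j := by
    rw [periodPartial, Finset.prod_range_succ', pow_zero, pow_one, mul_assoc, map_prod,
      ← Finset.prod_mul_distrib]
    have : ∀ j, algebraMap F⸨X⸩ (KSep F L) (periodFactor F q j)
        * (thetaSep F L ^ q ^ (j + 1) - thetaSep F L) = thetaSep F L ^ q ^ (j + 1) := fun j => by
      rw [thetaSep, ← map_pow, ← map_sub, ← map_mul, periodFactor_mul hq2]
    simp only [this]
    ring
  have hZ := PowerSeries.mul_inv_cancel _
    (constantCoeff_prod_C_sub_X_ne_zero (F := F) (L := L) hq2 l)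
  have hH := PowerSeries.mul_inv_cancel (etaTranslate F L q)
    (by rw [constantCoeff_etaTranslate hq2]; exact one_ne_zero)
  rw [← h5] at h2 h3
  rw [map_mul] at h2
  set Z := ∏ j ∈ Finset.range l,
    (PowerSeries.C (thetaSep F L ^ q ^ (j + 1) - thetaSep F L) - PowerSeries.X)
  set H := etaTranslate F L q
  set Hl := translate (taylorSep F L) (etaPartial q (thetaSep F L) l)
  set A := taylorSep F L (periodPartial F L q lam l)
  set M := taylorSep F L (∏ j ∈ Finset.range l, (thetaSep F L ^ q ^ (j + 1) - thetaSep F L))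
  set S := periodSeries q (thetaSep F L) lam l
  rw [← h3] at h2
  have h6 : A * H⁻¹ - S = ((A * M - S * Z) * H - (H - Hl) * (A * M)) * (H⁻¹ * Z⁻¹) := by
    linear_combination (S - A * H⁻¹) * hZ + S * Z * Z⁻¹ * hH - A * H⁻¹ * Z⁻¹ * h1
  rw [h6]
  exact (dvd_sub (h2.mul_right _) (h4.mul_right _)).mul_right _

end PeriodExpansion

/-! ### The period lattice -/

section Lattice

open Filter Topology
open scoped PowerSeries.WithPiTopology

/-- The matrix `θ I + N` is upper triangular, and the last row of `N` is zero. -/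
theorem aeval_lieTheta_last {L : Type*} [Field L] {n : ℕ} (θ : L) (P : Polynomial L)
    (r c : Fin n) (hr : r.val + 1 = n) :
    (Polynomial.aeval (lieTheta θ n) P) r c = if r = c then P.eval θ else 0 := by
  have h1 : ∀ c, lieTheta θ n r c = if r = c then θ else 0 := fun c => by
    rw [lieTheta, Matrix.add_apply, Matrix.smul_apply, Matrix.one_apply, shiftN, Matrix.of_apply,
      if_neg (show ¬ r.val + 1 = c.val by omega), add_zero]
    simp
  have h2 : ∀ (m : ℕ) (c : Fin n), (lieTheta θ n ^ m) r c = if r = c then θ ^ m else 0 := by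
    intro m
    induction m with
    | zero => intro c; simp [Matrix.one_apply]
    | succ m ih =>
      intro c
      rw [pow_succ, Matrix.mul_apply, Finset.sum_eq_single r, ih, h1]
      · simp [pow_succ]
      · intro b _ hb
        rw [ih, if_neg hb.symm, zero_mul]
      · simp
  induction P using Polynomial.induction_on' with
  | add P Q hP hQ =>
    rw [map_add, Matrix.add_apply, hP, hQ, Polynomial.eval_add]
    split_ifs <;> simp
  | monomial m a =>
    rw [Polynomial.aeval_monomial, Matrix.algebraMap_eq_diagonal, Matrix.diagonal_mul, h2,
      Polynomial.eval_monomial]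
    simp

theorem eval_thetaInf_coeff {F : Type*} [Field F] (a : Polynomial F) (k : ℕ) :
    (a.eval₂ HahnSeries.C (thetaInf F)).coeff (-(k : ℤ)) = a.coeff k := by
  rw [Polynomial.eval₂_eq_sum_range, HahnSeries.coeff_sum]
  have h : ∀ i, (HahnSeries.C (a.coeff i) * thetaInf F ^ i).coeff (-(k : ℤ))
      = if k = i then a.coeff i else 0 := fun i => by
    rw [thetaInf_pow, HahnSeries.C_mul_eq_smul, HahnSeries.coeff_smul, HahnSeries.coeff_single]
    by_cases hk : k = i <;> simp [hk]
  simp only [h]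
  rw [Finset.sum_ite_eq]
  split_ifs with hk
  · rfl
  · exact (Polynomial.coeff_eq_zero_of_natDegree_lt (by simpa using hk)).symm

variable {F : Type*} [Field F] {q : ℕ} {L : Type*} [NormedField L] [Algebra F⸨X⸩ L]

theorem algebraMap_thetaSep :
    algebraMap (KSep F L) L (thetaSep F L) = algebraMap F⸨X⸩ L (thetaInf F) := rfl

/-- Transcendence of `θ` over `F`: the coefficients of `a` are Laurent coefficients of `a(θ)`. -/
theorem eq_one_of_eval_map_eq_one (a : Polynomial F)
    (h : (a.map (constEmb F L)).eval (algebraMap (KSep F L) L (thetaSep F L)) = 1) : a = 1 := by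
  rw [algebraMap_thetaSep, Polynomial.eval_map, constEmb, ← Polynomial.hom_eval₂,
    ← map_one (algebraMap F⸨X⸩ L)] at h
  have h1 := (algebraMap F⸨X⸩ L).injective h
  ext k
  rw [← eval_thetaInf_coeff, h1, HahnSeries.coeff_one, Polynomial.coeff_one]
  simp only [neg_eq_zero, Nat.cast_eq_zero]

theorem norm_thetaSep (hL : ∀ x : F⸨X⸩, x ≠ 0 → ‖algebraMap F⸨X⸩ L x‖ = (q : ℝ) ^ (-x.order)) :
    ‖algebraMap (KSep F L) L (thetaSep F L)‖ = q := by
  rw [algebraMap_thetaSep, thetaInf, hL _ (HahnSeries.single_ne_zero one_ne_zero),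
    HahnSeries.order_single one_ne_zero, neg_neg, zpow_one]

theorem norm_algebraMap_le (hq2 : 2 ≤ q)
    (hL : ∀ x : F⸨X⸩, x ≠ 0 → ‖algebraMap F⸨X⸩ L x‖ = (q : ℝ) ^ (-x.order)) {x : F⸨X⸩} {l : ℕ}
    (hx : ∀ i ≤ (l : ℤ), x.coeff i = 0) : ‖algebraMap F⸨X⸩ L x‖ ≤ ((q : ℝ)⁻¹) ^ l := by
  have hq1 : (1 : ℝ) ≤ q := by exact_mod_cast (by omega : 1 ≤ q)
  by_cases h0 : x = 0
  · rw [h0, map_zero, norm_zero]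
    positivity
  · rw [hL x h0, inv_pow, ← zpow_natCast, ← zpow_neg]
    refine zpow_le_zpow_right₀ hq1 (neg_le_neg ?_)
    by_contra! h
    exact HahnSeries.coeff_order_eq_zero.not.mpr h0 (hx _ h.le)

/-- Hyperderivatives raise the order in `1/θ` by at least `j`, so they preserve coefficientwise
agreement and are continuous along such sequences. -/
theorem tendsto_algebraMap_hyperderivInf (hq2 : 2 ≤ q)
    (hL : ∀ x : F⸨X⸩, x ≠ 0 → ‖algebraMap F⸨X⸩ L x‖ = (q : ℝ) ^ (-x.order)) {x : F⸨X⸩}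
    {u : ℕ → F⸨X⸩} (hu : ∀ l : ℕ, ∀ i ≤ (l : ℤ), (x - u l).coeff i = 0) (j : ℕ) :
    Tendsto (fun l => algebraMap F⸨X⸩ L (hyperderivInf j (u l))) atTop
      (𝓝 (algebraMap F⸨X⸩ L (hyperderivInf j x))) := by
  have hq1 : (1 : ℝ) < q := by exact_mod_cast (by omega : 1 < q)
  rw [tendsto_iff_norm_sub_tendsto_zero]
  refine squeeze_zero (fun _ => norm_nonneg _) (fun l => ?_)
    (tendsto_pow_atTop_nhds_zero_of_lt_one (r := (q : ℝ)⁻¹) (by positivity) (inv_lt_one_of_one_lt₀ hq1))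
  rw [norm_sub_rev, ← map_sub]
  refine norm_algebraMap_le hq2 hL fun i hi => ?_
  rw [← coeff_taylorInf, ← coeff_taylorInf, ← map_sub, ← map_sub, coeff_taylorInf,
    hyperderivInf_coeff, hu l _ (by omega), smul_zero]

theorem map_taylorSep_algebraMap_coeff (x : F⸨X⸩) (j : ℕ) :
    PowerSeries.coeff j (PowerSeries.map (algebraMap (KSep F L) L)
      (taylorSep F L (algebraMap F⸨X⸩ (KSep F L) x))) = algebraMap F⸨X⸩ L (hyperderivInf j x) := by
  rw [(taylorSep_spec F L).2, PowerSeries.coeff_map, PowerSeries.coeff_map, coeff_taylorInf]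
  rfl

theorem map_periodSeries {k k' : Type*} [Field k] [Field k'] (g : k →+* k') {θ lam : k}
    (hθ : ∀ m, θ ^ q ^ (m + 1) - θ ≠ 0) (l : ℕ) :
    PowerSeries.map g (periodSeries q θ lam l) = periodSeries q (g θ) (g lam) l := by
  have h : ∀ j, PowerSeries.map g (PowerSeries.C (θ ^ q ^ (j + 1) - θ) - PowerSeries.X)⁻¹
      = (PowerSeries.C (g θ ^ q ^ (j + 1) - g θ) - PowerSeries.X)⁻¹ := fun j => by
    have h1 : PowerSeries.map g (PowerSeries.C (θ ^ q ^ (j + 1) - θ) - PowerSeries.X)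
        = PowerSeries.C (g θ ^ q ^ (j + 1) - g θ) - PowerSeries.X := by
      rw [map_sub, PowerSeries.map_C, PowerSeries.map_X, map_sub, map_pow]
    rw [map_inv_of_constantCoeff_ne_zero, h1]
    · simpa using hθ j
    · rw [h1]
      rw [← map_pow, ← map_sub, map_sub PowerSeries.constantCoeff, PowerSeries.constantCoeff_C,
        PowerSeries.constantCoeff_X, sub_zero]
      exact (map_ne_zero g).mpr (hθ j)
  rw [periodSeries, periodSeries, map_mul, PowerSeries.map_C, map_mul, map_prod, map_prod]
  simp only [h, map_pow]

/-- The approximate period series converge to the expansion of `π̃ / η`. -/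
theorem tendsto_periodSeries {p f : ℕ} [ExpChar (KSep F L) p] (hq : q = p ^ f) (hq2 : 2 ≤ q)
    (hL : ∀ x : F⸨X⸩, x ≠ 0 → ‖algebraMap F⸨X⸩ L x‖ = (q : ℝ) ^ (-x.order)) {lam : KSep F L}
    (hlam : lam ^ (q - 1) = -thetaSep F L) :
    Tendsto (fun l => periodSeries q (algebraMap (KSep F L) L (thetaSep F L))
      (algebraMap (KSep F L) L lam) l) atTop
      (𝓝 (PowerSeries.map (algebraMap (KSep F L) L) (periodExpansion F L q lam))) := by
  let m := PowerSeries.map (algebraMap (KSep F L) L)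
  -- Continuity is only needed on `K_∞`: the Taylor series of `λ θ` and the inverse translate of `η`
  -- are fixed factors.
  have h1 : Tendsto (fun l => m (taylorSep F L (algebraMap F⸨X⸩ (KSep F L)
      (∏ j ∈ Finset.range l, periodFactor F q j)))) atTop
      (𝓝 (m (taylorSep F L (algebraMap F⸨X⸩ (KSep F L)
        (∏' j : ℕ, (1 - thetaInf F ^ (1 - (q : ℤ) ^ (j + 1)))⁻¹))))) := by
    rw [PowerSeries.WithPiTopology.tendsto_iff_coeff_tendsto]
    intro j
    simp only [m, map_taylorSep_algebraMap_coeff]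
    exact tendsto_algebraMap_hyperderivInf hq2 hL (periodProduct_ne_zero_and_coeff_sub_eq_zero hq2).2 j
  have h2 : Tendsto (fun l => m (taylorSep F L (periodPartial F L q lam l)
      * (etaTranslate F L q)⁻¹)) atTop (𝓝 (m (periodExpansion F L q lam))) := by
    simp only [periodExpansion, periodPartial, carlitzPeriod, map_mul]
    exact (h1.const_mul _).mul_const _
  rw [PowerSeries.WithPiTopology.tendsto_iff_coeff_tendsto] at h2 ⊢
  intro j
  refine (h2 j).congr' ?_
  filter_upwards [eventually_ge_atTop j] with l hl
  rw [← map_periodSeries _ (thetaSep_qpow_sub_ne_zero hq2), PowerSeries.coeff_map,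
    PowerSeries.coeff_map]
  congr 1
  rw [← sub_eq_zero, ← map_sub]
  exact PowerSeries.X_pow_dvd_iff.mp (X_pow_dvd_sub_periodSeries hq hq2 hlam l) j (by omega)

theorem carlitzPeriod_ne_zero (hq2 : 2 ≤ q) {lam : KSep F L}
    (hlam : lam ^ (q - 1) = -thetaSep F L) : carlitzPeriod F q L lam ≠ 0 := by
  have hθ : thetaSep F L ≠ 0 :=
    (map_ne_zero _).mpr (HahnSeries.single_ne_zero one_ne_zero)
  refine mul_ne_zero (mul_ne_zero ?_ hθ) ((map_ne_zero _).mpr (periodProduct_ne_zero_and_coeff_sub_eq_zero hq2).1)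
  rintro rfl
  rw [zero_pow (by omega), eq_comm, neg_eq_zero] at hlam
  exact hθ hlam

/-- The vector of hyperderivatives of `(π̃ / η)^n` is a zero of the exponential function. -/
theorem tensorExp_periodExpansion [IsUltrametricDist L] [CompleteSpace L] {p f : ℕ}
    [ExpChar (KSep F L) p] [ExpChar L p] (hq : q = p ^ f) (hq2 : 2 ≤ q)
    (hL : ∀ x : F⸨X⸩, x ≠ 0 → ‖algebraMap F⸨X⸩ L x‖ = (q : ℝ) ^ (-x.order)) {lam : KSep F L}
    (hlam : lam ^ (q - 1) = -thetaSep F L) (n : ℕ) :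
    tensorExp q (algebraMap (KSep F L) L (thetaSep F L)) n (powCoeffs n
      (PowerSeries.map (algebraMap (KSep F L) L) (periodExpansion F L q lam))) = 0 := by
  have hq1 : (1 : ℝ) < q := by exact_mod_cast (by omega : 1 < q)
  refine tensorExp_eq_zero_of_tendsto hq2 (by rwa [norm_thetaSep hL])
    (y := fun l => powCoeffs n (periodSeries q (algebraMap (KSep F L) L (thetaSep F L))
      (algebraMap (KSep F L) L lam) l)) ?_ fun l hl =>
    sum_expCoeff_mulVec_powCoeffs hq hq2 (fun m => ?_) ?_ n hl
  · rw [tendsto_pi_nhds]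
    intro c
    have h := (tendsto_periodSeries hq hq2 hL hlam).pow n
    rw [PowerSeries.WithPiTopology.tendsto_iff_coeff_tendsto] at h
    exact h _
  · rw [← map_pow, ← map_sub]
    exact (map_ne_zero _).mpr (thetaSep_qpow_sub_ne_zero hq2 m)
  · rw [← map_pow, hlam, map_neg]

/-- A fundamental period whose last coordinate is `π̃^n` is the vector of hyperderivatives of
`(π̃ / η)^n`. -/
theorem eq_powCoeffs_of_isFundamentalPeriod [IsUltrametricDist L] [CompleteSpace L] {p f : ℕ}
    [ExpChar (KSep F L) p] [ExpChar L p] (hq : q = p ^ f) (hq2 : 2 ≤ q)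
    (hL : ∀ x : F⸨X⸩, x ≠ 0 → ‖algebraMap F⸨X⸩ L x‖ = (q : ℝ) ^ (-x.order)) {lam : KSep F L}
    (hlam : lam ^ (q - 1) = -thetaSep F L) {n : ℕ} {z : Fin n → L}
    (hz : IsFundamentalPeriod q (algebraMap (KSep F L) L (thetaSep F L)) n (constEmb F L) z)
    (r : Fin n) (hr : r.val + 1 = n)
    (hzr : z r = algebraMap (KSep F L) L (carlitzPeriod F q L lam) ^ n) :
    z = powCoeffs n (PowerSeries.map (algebraMap (KSep F L) L) (periodExpansion F L q lam)) := by
  -- The constructed kernel vector is a multiple of `z`; equality of the nonzero last coordinates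
  -- forces the multiplier to be 1.
  obtain ⟨a, ha⟩ := (hz _).mp (tensorExp_periodExpansion hq hq2 hL hlam n)
  have hz0 : z r ≠ 0 := by
    rw [hzr]
    exact pow_ne_zero _ ((map_ne_zero _).mpr (carlitzPeriod_ne_zero hq2 hlam))
  have h1 : powCoeffs n (PowerSeries.map (algebraMap (KSep F L) L) (periodExpansion F L q lam)) r
      = z r := by
    rw [powCoeffs, show n - 1 - r.val = 0 by omega, PowerSeries.coeff_zero_eq_constantCoeff_apply,
      map_pow, ← PowerSeries.coeff_zero_eq_constantCoeff_apply, PowerSeries.coeff_map,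
      PowerSeries.coeff_zero_eq_constantCoeff_apply, constantCoeff_periodExpansion hq2, hzr]
  have h2 := congr($ha r)
  rw [h1, Matrix.mulVec, dotProduct, Finset.sum_eq_single r (fun c _ hc => by
      rw [aeval_lieTheta_last _ _ r c hr, if_neg hc.symm, zero_mul]) (by simp),
    aeval_lieTheta_last _ _ r r hr, if_pos rfl, eq_comm, mul_eq_right₀ hz0] at h2
  rw [ha, eq_one_of_eval_map_eq_one a h2, Polynomial.map_one, map_one, Matrix.one_mulVec]

end Lattice

end CarlitzPeriod

end

theorem corollary4p8 (F : Type*) [Field F] [Fintype F] (q : ℕ) (hq : Fintype.card F = q)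
    (L : Type*) [NormedField L] [IsUltrametricDist L] [CompleteSpace L] [IsAlgClosed L]
    [Algebra F⸨X⸩ L]
    (hL : ∀ x : F⸨X⸩, x ≠ 0 → ‖algebraMap F⸨X⸩ L x‖ = (q : ℝ) ^ (-x.order))
    (lam : KSep F L) (hlam : lam ^ (q - 1) = -thetaSep F L) (n : ℕ) (hn : 1 ≤ n) :
    (∀ j ≤ n,
      PowerSeries.constantCoeff (hyperderivSeries F L j (eta q (thetaSep F L) ^ n)⁻¹)
        = (hyperderivPoly F L j (andersonThakurQuot q (thetaSep F L) n)).eval (thetaSep F L)) ∧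
    ∀ z : Fin n → L,
      IsFundamentalPeriod q (thetaSep F L : L) n (constEmb F L) z →
      z ⟨n - 1, Nat.sub_one_lt_of_lt hn⟩ = (carlitzPeriod F q L lam : L) ^ n →
      ∀ j (hj : j < n), z ⟨n - 1 - j, by omega⟩
        = ((hyperderivPoly F L j (andersonThakurQuot q (thetaSep F L) n *
            Polynomial.C (carlitzPeriod F q L lam ^ n))).eval (thetaSep F L) : KSep F L) := by
  have hq2 : 2 ≤ q := hq ▸ Fintype.one_lt_card
  obtain ⟨p, hp⟩ := CharP.exists F
  obtain ⟨f, hprime, hcard⟩ := FiniteField.card F p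
  have hqp : q = p ^ (f : ℕ) := hq.symm.trans hcard
  have : ExpChar F p := ExpChar.prime hprime
  have : ExpChar L p := expChar_of_injective_ringHom (constEmb F L).injective p
  have : ExpChar (KSep F L) p :=
    expChar_of_injective_ringHom ((algebraMap F⸨X⸩ (KSep F L)).comp HahnSeries.C).injective p
  refine ⟨fun j hj => hyperderiv_eta_inv_eq hqp hq2 hn hj, fun z hz hzr j hj => ?_⟩
  rw [eval_hyperderivPoly_mul_period hqp hq2 lam hn hj.le,
    eq_powCoeffs_of_isFundamentalPeriod hqp hq2 hL hlam hz ⟨n - 1, by omega⟩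
      (Nat.sub_add_cancel hn) hzr, powCoeffs, ← map_pow, PowerSeries.coeff_map]
  simp only [show n - 1 - (n - 1 - j) = j by omega]
  rfl
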